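/- **Conventions.** Let $\Gamma$ be a countable discrete group. A *measured $\Gamma$-Boolean algebra* $(P,\mu)$ is a Boolean algebra $P$ with a map $\mu\colon P\to[0,1]$ such that $\mu(0)=0$, $\mu(1)=1$, $\mu(X\cup Y)+\mu(X\cap Y)=\mu(X)+\mu(Y)$, and with an action of $\Gamma$ by $\mu$-preserving Boolean automorphisms; put $d(X,Y)=\mu(X\cup Y)-\mu(X\cap Y)$. The *metric ultraproduct* of a family $(P_j,\mu_j)_{j\in I}$ along a non-principal ultrafilter $\mathcal U$ on $I$ is $\prod_j P_j/\!\sim$, where $(X_j)\sim(Y_j)$ iff $\lim_{j\to\mathcal U}d_j(X_j,Y_j)=0$, with $\mu_{\mathcal U}([X_j])=\lim_{j\to\mathcal U}\mu_j(X_j)$. $P$ is *weakly contained* in a family $\mathcal P$ if there is a measure-preserving $\Gamma$-equivariant homomorphism of Boolean algebras from $P$ to a metric ultraproduct of members of $\mathcal P$. *Finite actions* are the measured $\Gamma$-Boolean algebras with finite underlying algebra; *finite transitive actions* are the power sets of finite non-empty transitive $\Gamma$-sets with normalized counting measure. For a finite abelian group $A$, $P(A)$ is the abelian group of formal sums $\sum_{a\neq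 0}X_a\otimes a$ with pairwise disjoint $X_a\in P$, where $X\otimes a+Y\otimes b=(X\setminus Y)\otimes a+(Y\setminus X)\otimes b+(X\cap Y)\otimes(a+b)$; it is a $\mathbb Z\Gamma$-module, with length $\mu(\sum_{a\ne0} X_a\otimes a)=\sum_{a\neq0}\mu(X_a)$. $\Gamma$ is *of finite type* if there is a contractible simplicial complex $E\Gamma$ with a simplicial $\Gamma$-action that is free on the geometric realization and has finitely many orbits of simplices. Fix such an $E\Gamma$, put $B\Gamma=E\Gamma/\Gamma$, and fix a probability measure $\nu$ of full support on the set $B\Gamma(2)$ of $2$-simplices. Let $H^i(B\Gamma,M)$ be the cohomology of $\mathrm{Hom}_{\mathbb Z\Gamma}(C_*(E\Gamma),M)$. For $\alpha\in H^2(B\Gamma,P(A))$ let $|||\alpha|||$ be the infimum of $\|c\|=\sum_{x\in B\Gamma(2)}\mu(c(x))\,\nu(x)$ over all cocycles $c$ representing $\alpha$. $\Gamma$ satisfies a *cosystolic inequality in dimension $2$ for all finite transitive actions with coefficients in $A$* if there is $\varepsilon>0$ such that $|||\alpha|||\ge\varepsilon$ for all finite transitive $\Gamma$-actions $P$ and all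 $0\neq\alpha\in H^2(B\Gamma,P(A))$. Let $\pi\colon F\to\Gamma$ be a surjection from a free group of finite rank. A *sofic approximation* of $\Gamma$ is a sequence of homomorphisms $\sigma_n\colon F\to\mathrm{Sym}(k_n)$, $k_n\geq 1$, such that $\frac1{k_n}|\{i:\sigma_n(g)i\ne i\}|$ tends to $0$ for every $g\in\ker\pi$ and to $1$ for every $g\notin\ker\pi$. Its *limit action* along a non-principal ultrafilter $\mathcal U$ on $\mathbb N$ is the metric ultraproduct of the power sets of $\{1,\dots,k_n\}$ with normalized counting measure, on which $F$ acts through $\Gamma$. $\Gamma$ is *stable in finite actions* if the limit action of every sofic approximation of $\Gamma$ is weakly contained in the family of finite $\Gamma$-actions. A p.m.p. action $\Gamma\curvearrowright(X,\mu)$ is *sofic* if its measure algebra $M(X,\mu)$ is weakly contained in the limit action of some sofic approximation of $\Gamma$. **Corollary.** Let $\Gamma$ be a countable discrete group, $A$ a finite abelian group, and assume that (i) $\Gamma$ is residually finite and of finite type, (ii) $\Gamma$ satisfies a cosystolic inequality in dimension $2$ for all finite transitive actions with coefficients in $A$, (iii) $1\to A\to\tilde\Gamma\to\Gamma\to1$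 is a central extension such that $\tilde\Gamma$ is not residually finite, and that $\Gamma$ is stable in finite actions. Let $\{0,1\}^{\tilde\Gamma}$ carry the product of the uniform measures on $\{0,1\}$ and the shift action $(gx)(h)=x(g^{-1}h)$ of $\tilde\Gamma$, and let $\{0,1\}^{\tilde\Gamma}/A$ be the space of $A$-orbits with the push-forward measure and the induced action of $\Gamma=\tilde\Gamma/A$. Then the p.m.p. action $\Gamma\curvearrowright\{0,1\}^{\tilde\Gamma}/A$ is not sofic. -/

import Mathlib

universe u v w

/-- A measured `Γ`-Boolean algebra. -/
structure MeasuredBoolAlg (Γ : Type u) [Group Γ] where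
  carrier : Type v
  [boolAlg : BooleanAlgebra carrier]
  μ : carrier → ℝ
  μ_nonneg : ∀ X, 0 ≤ μ X
  μ_le_one : ∀ X, μ X ≤ 1
  μ_sup_add_inf : ∀ X Y, μ (X ⊔ Y) + μ (X ⊓ Y) = μ X + μ Y
  μ_bot : μ ⊥ = 0
  μ_top : μ ⊤ = 1
  act : Γ →* (carrier ≃o carrier)
  μ_act : ∀ g X, μ (act g X) = μ X

attribute [instance] MeasuredBoolAlg.boolAlg

namespace MeasuredBoolAlg

variable {Γ : Type u} [Group Γ]

def actOfMonotone {P : Type v} [PartialOrder P] (f : Γ → P → P) (h_one : ∀ X, f 1 X = X)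
    (h_mul : ∀ g h X, f (g * h) X = f g (f h X)) (h_mono : ∀ g, Monotone (f g)) :
    Γ →* (P ≃o P) where
  toFun g :=
    { toFun := f g
      invFun := f g⁻¹
      left_inv := fun X => by rw [← h_mul, inv_mul_cancel, h_one]
      right_inv := fun X => by rw [← h_mul, mul_inv_cancel, h_one]
      map_rel_iff' := fun {X Y} => ⟨fun h => by
        have := h_mono g⁻¹ h
        simpa [← h_mul, h_one] using this, fun h => h_mono g h⟩ }
  map_one' := by ext X; exact h_one X
  map_mul' g h := by ext X; exact h_mul g h X

variable (P : MeasuredBoolAlg.{u, v} Γ)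

/-- The pseudo-metric `d(X, Y) = μ(X ∪ Y) - μ(X ∩ Y)`. -/
def dist (X Y : P.carrier) : ℝ := P.μ (X ⊔ Y) - P.μ (X ⊓ Y)

theorem μ_mono {X Y : P.carrier} (h : X ≤ Y) : P.μ X ≤ P.μ Y := by
  have h1 := P.μ_sup_add_inf X (Y \ X)
  rw [sup_sdiff_cancel_right h, inf_sdiff_self_right, P.μ_bot] at h1
  linarith [P.μ_nonneg (Y \ X)]

theorem μ_sup_eq_zero {X Y : P.carrier} (hX : P.μ X = 0) (hY : P.μ Y = 0) : P.μ (X ⊔ Y) = 0 := by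
  linarith [P.μ_sup_add_inf X Y, P.μ_nonneg (X ⊓ Y), P.μ_nonneg (X ⊔ Y)]

theorem dist_eq (X Y : P.carrier) : P.dist X Y = P.μ (symmDiff X Y) := by
  have h := P.μ_sup_add_inf (symmDiff X Y) (X ⊓ Y)
  rw [symmDiff_sup_inf, (disjoint_symmDiff_inf X Y).eq_bot, P.μ_bot] at h
  unfold dist
  linarith

theorem dist_eq_zero_iff {X Y : P.carrier} :
    P.dist X Y = 0 ↔ ∃ N, P.μ N = 0 ∧ X ⊔ N = Y ⊔ N := by
  rw [dist_eq]
  constructor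
  · refine fun h => ⟨_, h, ?_⟩
    have h1 : X ⊔ symmDiff X Y = X ⊔ Y := by
      rw [symmDiff, ← sup_assoc, sup_eq_left.2 sdiff_le, sup_sdiff_self_right]
    have h2 : Y ⊔ symmDiff X Y = Y ⊔ X := by
      rw [symmDiff, sup_comm (X \ Y), ← sup_assoc, sup_eq_left.2 sdiff_le, sup_sdiff_self_right]
    rw [h1, h2, sup_comm]
  · rintro ⟨N, hN, h⟩
    refine le_antisymm ?_ (P.μ_nonneg _)
    rw [← hN]
    refine P.μ_mono ?_
    rw [symmDiff_le_iff]
    exact ⟨h ▸ le_sup_left, h ▸ le_sup_left⟩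

/-- Two elements at distance `0` are identified. -/
def nullSetoid : Setoid P.carrier where
  r X Y := P.dist X Y = 0
  iseqv :=
    { refl := fun X => by simp [dist]
      symm := fun {X Y} h => by rw [dist, sup_comm, inf_comm]; exact h
      trans := fun {X Y Z} h1 h2 => by
        rw [dist_eq_zero_iff] at *
        obtain ⟨N, hN, h1⟩ := h1
        obtain ⟨M, hM, h2⟩ := h2
        refine ⟨N ⊔ M, P.μ_sup_eq_zero hN hM, ?_⟩
        rw [← sup_assoc, h1, sup_right_comm, h2, sup_assoc, sup_comm M N] }

theorem sup_congr {X X' Y Y' : P.carrier} (hX : P.dist X X' = 0) (hY : P.dist Y Y' = 0) :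
    P.dist (X ⊔ Y) (X' ⊔ Y') = 0 := by
  rw [dist_eq_zero_iff] at *
  obtain ⟨N, hN, h1⟩ := hX
  obtain ⟨M, hM, h2⟩ := hY
  refine ⟨N ⊔ M, P.μ_sup_eq_zero hN hM, ?_⟩
  rw [sup_sup_sup_comm, h1, h2, sup_sup_sup_comm]

theorem compl_congr {X Y : P.carrier} (h : P.dist X Y = 0) : P.dist Xᶜ Yᶜ = 0 := by
  rw [dist_eq] at *
  rwa [compl_symmDiff_compl]

theorem inf_congr {X X' Y Y' : P.carrier} (hX : P.dist X X' = 0) (hY : P.dist Y Y' = 0) :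
    P.dist (X ⊓ Y) (X' ⊓ Y') = 0 := by
  have h := P.compl_congr (P.sup_congr (P.compl_congr hX) (P.compl_congr hY))
  simpa using h

/-- The quotient of a measured Boolean algebra by the relation `d(X, Y) = 0`. -/
def Reduced : Type v := Quotient P.nullSetoid

namespace Reduced

variable {P}

def mk (X : P.carrier) : Reduced P := Quotient.mk P.nullSetoid X

theorem mk_surjective : Function.Surjective (mk : P.carrier → Reduced P) := Quotient.mk_surjective

theorem mk_eq_mk {X Y : P.carrier} : mk X = mk Y ↔ P.dist X Y = 0 := Quotient.eq

instance : Max (Reduced P) where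
  max := Quotient.map₂ (· ⊔ ·) fun _ _ h _ _ h' => P.sup_congr h h'

instance : Min (Reduced P) where
  min := Quotient.map₂ (· ⊓ ·) fun _ _ h _ _ h' => P.inf_congr h h'

instance : Compl (Reduced P) where
  compl := Quotient.map (·ᶜ) fun _ _ h => P.compl_congr h

theorem mk_sup (X Y : P.carrier) : mk (X ⊔ Y) = mk X ⊔ mk Y := rfl
theorem mk_inf (X Y : P.carrier) : mk (X ⊓ Y) = mk X ⊓ mk Y := rfl
theorem mk_compl (X : P.carrier) : mk Xᶜ = (mk X)ᶜ := rfl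

instance : Lattice (Reduced P) :=
  Lattice.mk'
    (fun a b => by
      induction a, b using Quotient.inductionOn₂; exact congrArg mk (sup_comm _ _))
    (fun a b c => by
      induction a, b, c using Quotient.inductionOn₃; exact congrArg mk (sup_assoc _ _ _))
    (fun a b => by
      induction a, b using Quotient.inductionOn₂; exact congrArg mk (inf_comm _ _))
    (fun a b c => by
      induction a, b, c using Quotient.inductionOn₃; exact congrArg mk (inf_assoc _ _ _))
    (fun a b => by
      induction a, b using Quotient.inductionOn₂; exact congrArg mk sup_inf_self)
    (fun a b => by
      induction a, b using Quotient.inductionOn₂; exact congrArg mk inf_sup_self)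

theorem mk_mono {X Y : P.carrier} (h : X ≤ Y) : mk X ≤ mk Y :=
  sup_eq_right.1 ((mk_sup X Y).symm.trans (congrArg mk (sup_eq_right.2 h)))

instance : BooleanAlgebra (Reduced P) where
  __ := (inferInstance : Lattice (Reduced P))
  le_sup_inf a b c := by
    induction a, b, c using Quotient.inductionOn₃
    exact mk_mono le_sup_inf
  compl a := aᶜ
  top := mk ⊤
  bot := mk ⊥
  inf_compl_le_bot a := by
    induction a using Quotient.inductionOn
    exact mk_mono inf_compl_eq_bot.le
  top_le_sup_compl a := by
    induction a using Quotient.inductionOn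
    exact mk_mono sup_compl_eq_top.ge
  le_top a := by
    induction a using Quotient.inductionOn
    exact mk_mono le_top
  bot_le a := by
    induction a using Quotient.inductionOn
    exact mk_mono bot_le

end Reduced

theorem μ_congr {X Y : P.carrier} (h : P.dist X Y = 0) : P.μ X = P.μ Y := by
  have h1 := P.μ_mono (inf_le_left : X ⊓ Y ≤ X)
  have h2 := P.μ_mono (inf_le_right : X ⊓ Y ≤ Y)
  have h3 := P.μ_mono (le_sup_left : X ≤ X ⊔ Y)
  have h4 := P.μ_mono (le_sup_right : Y ≤ X ⊔ Y)
  unfold dist at h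
  linarith

theorem dist_act (g : Γ) (X Y : P.carrier) : P.dist (P.act g X) (P.act g Y) = P.dist X Y := by
  simp only [dist, ← map_sup, ← map_inf, P.μ_act]

/-- The quotient of a measured `Γ`-Boolean algebra by the relation `d(X, Y) = 0`, which makes the
measure faithful. -/
def reduced : MeasuredBoolAlg.{u, v} Γ where
  carrier := Reduced P
  μ := Quotient.lift P.μ fun _ _ h => P.μ_congr h
  μ_nonneg a := by induction a using Quotient.inductionOn; exact P.μ_nonneg _
  μ_le_one a := by induction a using Quotient.inductionOn; exact P.μ_le_one _
  μ_sup_add_inf a b := by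
    induction a, b using Quotient.inductionOn₂; exact P.μ_sup_add_inf _ _
  μ_bot := P.μ_bot
  μ_top := P.μ_top
  act := actOfMonotone
    (fun g => Quotient.map (P.act g) fun X Y h => (P.dist_act g X Y).trans h)
    (fun a => by
      induction a using Quotient.inductionOn
      rename_i X
      exact congrArg Reduced.mk (by rw [map_one]; rfl : P.act 1 X = X))
    (fun g h a => by
      induction a using Quotient.inductionOn
      rename_i X
      exact congrArg Reduced.mk (by rw [map_mul]; rfl : P.act (g * h) X = P.act g (P.act h X)))
    (fun g a b hab => by
      induction a, b using Quotient.inductionOn₂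
      rename_i X Y
      have h1 : Reduced.mk (X ⊔ Y) = Reduced.mk Y := (Reduced.mk_sup X Y).trans (sup_eq_right.2 hab)
      have h2 : P.dist (P.act g (X ⊔ Y)) (P.act g Y) = 0 :=
        (P.dist_act g _ _).trans (Reduced.mk_eq_mk.1 h1)
      rw [map_sup] at h2
      exact sup_eq_right.1 (Reduced.mk_eq_mk.2 h2))
  μ_act g a := by
    induction a using Quotient.inductionOn
    exact P.μ_act g _


/-- `P` is contained in `Q`: there is a measure-preserving, `Γ`-equivariant homomorphism of Boolean
algebras from `P` to `Q`. -/
def IsContainedIn (P : MeasuredBoolAlg.{u, v} Γ) (Q : MeasuredBoolAlg.{u, w} Γ) : Prop :=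
  ∃ f : BoundedLatticeHom P.carrier Q.carrier,
    (∀ X, Q.μ (f X) = P.μ X) ∧ ∀ g X, f (P.act g X) = Q.act g (f X)

theorem tendsto_limUnder {I : Type w} (U : Ultrafilter I) {f : I → ℝ}
    (h0 : ∀ i, 0 ≤ f i) (h1 : ∀ i, f i ≤ 1) :
    Filter.Tendsto f U (nhds (Filter.limUnder (U : Filter I) f)) := by
  obtain ⟨x, -, hx⟩ := (isCompact_Icc (a := (0 : ℝ)) (b := 1)).ultrafilter_le_nhds (U.map f)
    (Filter.tendsto_principal.2 (Filter.Eventually.of_forall fun i => ⟨h0 i, h1 i⟩))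
  exact tendsto_nhds_limUnder ⟨x, hx⟩

/-- The product of a family of measured `Γ`-Boolean algebras, with the (non-faithful) measure
`μ(X) = lim_{j → U} μ_j(X_j)`. -/
noncomputable def limProd {I : Type w} (U : Ultrafilter I) (P : I → MeasuredBoolAlg.{u, v} Γ) :
    MeasuredBoolAlg.{u, max v w} Γ where
  carrier := ∀ j, (P j).carrier
  μ X := Filter.limUnder (U : Filter I) fun j => (P j).μ (X j)
  μ_nonneg X := ge_of_tendsto'
    (tendsto_limUnder U (fun j => (P j).μ_nonneg (X j)) fun j => (P j).μ_le_one (X j))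
    fun j => (P j).μ_nonneg (X j)
  μ_le_one X := le_of_tendsto'
    (tendsto_limUnder U (fun j => (P j).μ_nonneg (X j)) fun j => (P j).μ_le_one (X j))
    fun j => (P j).μ_le_one (X j)
  μ_sup_add_inf X Y := by
    have h (Z : ∀ j, (P j).carrier) :=
      tendsto_limUnder U (fun j => (P j).μ_nonneg (Z j)) fun j => (P j).μ_le_one (Z j)
    refine tendsto_nhds_unique ((h (X ⊔ Y)).add (h (X ⊓ Y))) ?_
    simpa only [Pi.sup_apply, Pi.inf_apply, (P _).μ_sup_add_inf] using (h X).add (h Y)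
  μ_bot := by
    simp only [Pi.bot_apply, (P _).μ_bot]
    exact tendsto_const_nhds.limUnder_eq
  μ_top := by
    simp only [Pi.top_apply, (P _).μ_top]
    exact tendsto_const_nhds.limUnder_eq
  act := actOfMonotone (fun g X j => (P j).act g (X j))
    (fun X => by funext j; rw [map_one]; rfl)
    (fun g h X => by funext j; rw [map_mul]; rfl)
    (fun g X Y h j => ((P j).act g).monotone (h j))
  μ_act g X := by
    change (Filter.limUnder (U : Filter I) fun j => (P j).μ ((P j).act g (X j))) = _
    simp only [(P _).μ_act]

/-- The metric ultraproduct of a family of measured `Γ`-Boolean algebras: the quotient of the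
product by `X ∼ Y ↔ lim_{j → U} d_j(X_j, Y_j) = 0`, with the measure `lim_{j → U} μ_j`. -/
noncomputable def ultraproduct {I : Type w} (U : Ultrafilter I)
    (P : I → MeasuredBoolAlg.{u, v} Γ) : MeasuredBoolAlg.{u, max v w} Γ :=
  (limProd U P).reduced

theorem dist_limProd {I : Type w} (U : Ultrafilter I) (P : I → MeasuredBoolAlg.{u, v} Γ)
    (X Y : ∀ j, (P j).carrier) :
    (limProd U P).dist X Y = Filter.limUnder (U : Filter I) fun j => (P j).dist (X j) (Y j) := by
  have h (Z : ∀ j, (P j).carrier) :=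
    tendsto_limUnder U (fun j => (P j).μ_nonneg (Z j)) fun j => (P j).μ_le_one (Z j)
  exact ((h (X ⊔ Y)).sub (h (X ⊓ Y))).limUnder_eq.symm

/-- An ultrafilter is non-principal if it contains no finite set. -/
def IsNonprincipal {I : Type w} (U : Ultrafilter I) : Prop := ∀ s ∈ U, s.Infinite

/-- `P` is weakly contained in the family `F`: it is contained in a metric ultraproduct of members
of `F`. -/
def IsWeaklyContainedIn (P : MeasuredBoolAlg.{u, v} Γ) (F : Set (MeasuredBoolAlg.{u, 0} Γ)) :
    Prop :=
  ∃ (I : Type) (U : Ultrafilter I) (Q : I → MeasuredBoolAlg.{u, 0} Γ),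
    IsNonprincipal U ∧ (∀ j, Q j ∈ F) ∧ P.IsContainedIn (ultraproduct U Q)

/-- The power set of a finite non-empty set on which `Γ` acts, with the normalized counting
measure. -/
noncomputable def powerSet (X : Type v) [Finite X] [Nonempty X] (σ : Γ →* Equiv.Perm X) :
    MeasuredBoolAlg.{u, v} Γ where
  carrier := Set X
  μ S := (S.ncard : ℝ) / Nat.card X
  μ_nonneg S := by positivity
  μ_le_one S := by
    refine div_le_one_of_le₀ ?_ (Nat.cast_nonneg _)
    exact_mod_cast Set.ncard_le_card S
  μ_sup_add_inf S T := by
    rw [← add_div, ← add_div]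
    congr 1
    exact_mod_cast Set.ncard_union_add_ncard_inter S T
  μ_bot := by simp
  μ_top := by simp [Set.ncard_univ]
  act := actOfMonotone (fun g S => σ g '' S)
    (fun S => by simp)
    (fun g h S => by rw [map_mul, Equiv.Perm.coe_mul, Set.image_comp])
    (fun g => Set.monotone_image)
  μ_act g S := by
    change ((σ g '' S).ncard : ℝ) / _ = _
    rw [Set.ncard_image_of_injective _ (σ g).injective]

/-- The family of finite actions: finite measured `Γ`-Boolean algebras. -/
def finiteActions (Γ : Type u) [Group Γ] : Set (MeasuredBoolAlg.{u, 0} Γ) :=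
  {P | Finite P.carrier}

/-- The family of finite transitive actions. -/
def finiteTransitiveActions (Γ : Type u) [Group Γ] : Set (MeasuredBoolAlg.{u, 0} Γ) :=
  {P | ∃ (X : Type) (_ : Finite X) (_ : Nonempty X) (σ : Γ →* Equiv.Perm X),
    (∀ x y, ∃ g, σ g x = y) ∧ P = powerSet X σ}

open MeasureTheory in
/-- The measurable subsets of a probability space with a measure-preserving action. -/
noncomputable def measurableSets {X : Type v} [MeasurableSpace X] (μ : Measure X)
    [IsProbabilityMeasure μ] (ρ : Γ →* Equiv.Perm X) (hρ : ∀ g, MeasurePreserving (ρ g) μ μ) :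
    MeasuredBoolAlg.{u, v} Γ where
  carrier := {S : Set X // MeasurableSet S}
  μ S := μ.real S
  μ_nonneg S := measureReal_nonneg
  μ_le_one S := measureReal_le_one
  μ_sup_add_inf S T := measureReal_union_add_inter T.2
  μ_bot := measureReal_empty
  μ_top := probReal_univ
  act := actOfMonotone (fun g S => ⟨ρ g '' S, by
      rw [Equiv.image_eq_preimage_symm, ← Equiv.Perm.inv_def, ← map_inv]
      exact (hρ g⁻¹).measurable S.2⟩)
    (fun S => by ext; simp)
    (fun g h S => by
      apply Subtype.ext
      change ρ (g * h) '' _ = ρ g '' (ρ h '' _)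
      rw [map_mul, Equiv.Perm.coe_mul, Set.image_comp])
    (fun g S T h => Set.image_mono h)
  μ_act g S := by
    change μ.real (ρ g '' S) = μ.real S
    have h := (hρ g⁻¹).measureReal_preimage S.2.nullMeasurableSet
    rwa [map_inv, Equiv.Perm.inv_def, ← Equiv.image_eq_preimage_symm] at h

open MeasureTheory in
/-- The measure algebra `M(X, μ)` of a probability measure preserving action: measurable sets up to
measure zero. -/
noncomputable def measureAlgebra {X : Type v} [MeasurableSpace X] (μ : Measure X)
    [IsProbabilityMeasure μ] (ρ : Γ →* Equiv.Perm X) (hρ : ∀ g, MeasurePreserving (ρ g) μ μ) :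
    MeasuredBoolAlg.{u, v} Γ :=
  (measurableSets μ ρ hρ).reduced

end MeasuredBoolAlg

section Soficity

/-- The normalized Hamming length `ℓ(σ) = |{i | σ(i) ≠ i}| / n` of a permutation. -/
noncomputable def hammingLength {n : ℕ} (σ : Equiv.Perm (Fin n)) : ℝ :=
  ({i | σ i ≠ i} : Set (Fin n)).ncard / n

/-- A sofic approximation of `Γ` with respect to a surjection `π` from a free group of finite rank:
a sequence of permutation representations of the free group on finite non-empty sets, in which
the relations of `Γ` act asymptotically trivially and all other elements act asymptotically
without fixed points. (Hamming length is subadditive and conjugation invariant, so it amounts to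
the same to ask for the first property only for a set of normal generators of `ker π`.) -/
structure SoficApproximation {Γ : Type u} [Group Γ] {m : ℕ} (π : FreeGroup (Fin m) →* Γ) where
  k : ℕ → ℕ
  k_pos : ∀ n, 0 < k n
  σ : ∀ n, FreeGroup (Fin m) →* Equiv.Perm (Fin (k n))
  tendsto_zero : ∀ r ∈ π.ker,
    Filter.Tendsto (fun n => hammingLength (σ n r)) Filter.atTop (nhds 0)
  tendsto_one : ∀ g ∉ π.ker,
    Filter.Tendsto (fun n => hammingLength (σ n g)) Filter.atTop (nhds 1)

namespace SoficApproximation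

variable {Γ : Type u} [Group Γ] {m : ℕ} {π : FreeGroup (Fin m) →* Γ} (s : SoficApproximation π)

/-- The measured Boolean algebra of the `n`-th permutation representation. -/
noncomputable def algebra (n : ℕ) : MeasuredBoolAlg.{0, 0} (FreeGroup (Fin m)) :=
  haveI : Nonempty (Fin (s.k n)) := ⟨⟨0, s.k_pos n⟩⟩
  MeasuredBoolAlg.powerSet (Fin (s.k n)) (s.σ n)

theorem dist_act_le (n : ℕ) (g : FreeGroup (Fin m)) (X : Set (Fin (s.k n))) :
    (s.algebra n).dist ((s.algebra n).act g X) X ≤ hammingLength (s.σ n g) := by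
  refine (MeasuredBoolAlg.dist_eq _ _ _).le.trans ?_
  change ((symmDiff (s.σ n g '' X) X : Set (Fin (s.k n))).ncard : ℝ) / Nat.card (Fin (s.k n)) ≤ _
  rw [Nat.card_fin, hammingLength]
  gcongr
  · exact Set.toFinite _
  · rintro y (⟨⟨x, hx, rfl⟩, hy⟩ | ⟨hy, hy'⟩) h
    · exact hy (by rwa [(s.σ n g).injective h])
    · exact hy' ⟨y, hy, h⟩

theorem le_atTop {U : Ultrafilter ℕ} (hU : MeasuredBoolAlg.IsNonprincipal U) :
    (U : Filter ℕ) ≤ Filter.atTop := by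
  rw [← Nat.cofinite_eq_atTop]
  intro t ht
  by_contra h
  exact hU _ (Ultrafilter.compl_mem_iff_notMem.2 h) ht

theorem act_eq_one {U : Ultrafilter ℕ} (hU : MeasuredBoolAlg.IsNonprincipal U)
    {r : FreeGroup (Fin m)} (hr : r ∈ π.ker) :
    (MeasuredBoolAlg.ultraproduct U s.algebra).act r = 1 := by
  ext a
  obtain ⟨X, rfl⟩ := MeasuredBoolAlg.Reduced.mk_surjective a
  refine MeasuredBoolAlg.Reduced.mk_eq_mk.2 ?_
  refine (MeasuredBoolAlg.dist_limProd U _ _ _).trans ?_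
  refine Filter.Tendsto.limUnder_eq ?_
  refine tendsto_of_tendsto_of_tendsto_of_le_of_le tendsto_const_nhds
    ((s.tendsto_zero r hr).mono_left (le_atTop hU)) (fun n => ?_) fun n => s.dist_act_le n r (X n)
  rw [MeasuredBoolAlg.dist_eq]
  exact (s.algebra n).μ_nonneg _

/-- The limit action of a sofic approximation of `Γ`: the metric ultraproduct of the measured
Boolean algebras of the approximation, on which the action of the free group factors
through `Γ`. -/
noncomputable def limitAction (hπ : Function.Surjective π) (U : Ultrafilter ℕ)
    (hU : MeasuredBoolAlg.IsNonprincipal U) : MeasuredBoolAlg.{u, 0} Γ :=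
  let P := MeasuredBoolAlg.ultraproduct U s.algebra
  { carrier := P.carrier
    μ := P.μ
    μ_nonneg := P.μ_nonneg
    μ_le_one := P.μ_le_one
    μ_sup_add_inf := P.μ_sup_add_inf
    μ_bot := P.μ_bot
    μ_top := P.μ_top
    act := π.liftOfSurjective hπ ⟨P.act, fun _ hr => s.act_eq_one hU hr⟩
    μ_act := fun g X => by
      obtain ⟨f, rfl⟩ := hπ g
      rw [MonoidHom.liftOfRightInverse_comp_apply]
      exact P.μ_act f X }

theorem limitAction_act (hπ : Function.Surjective π) (U : Ultrafilter ℕ)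
    (hU : MeasuredBoolAlg.IsNonprincipal U) (f : FreeGroup (Fin m)) :
    (s.limitAction hπ U hU).act (π f) = (MeasuredBoolAlg.ultraproduct U s.algebra).act f :=
  MonoidHom.liftOfRightInverse_comp_apply _ _ _ _ _

end SoficApproximation

/-- `Γ` is stable in finite actions: the limit action of any sofic approximation of `Γ` is weakly
contained in the family of finite `Γ`-actions. -/
def IsStableInFiniteActions (Γ : Type u) [Group Γ] : Prop :=
  ∀ (m : ℕ) (π : FreeGroup (Fin m) →* Γ) (hπ : Function.Surjective π) (s : SoficApproximation π)
    (U : Ultrafilter ℕ) (hU : MeasuredBoolAlg.IsNonprincipal U),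
    (s.limitAction hπ U hU).IsWeaklyContainedIn (MeasuredBoolAlg.finiteActions Γ)

open MeasureTheory in
/-- A probability measure preserving action of `Γ` is sofic if it is weakly contained in the limit
action of some sofic approximation of `Γ`. -/
def IsSoficAction {Γ : Type u} [Group Γ] {X : Type v} [MeasurableSpace X] (μ : Measure X)
    [IsProbabilityMeasure μ] (ρ : Γ →* Equiv.Perm X) (hρ : ∀ g, MeasurePreserving (ρ g) μ μ) :
    Prop :=
  ∃ (m : ℕ) (π : FreeGroup (Fin m) →* Γ) (hπ : Function.Surjective π) (s : SoficApproximation π)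
    (U : Ultrafilter ℕ) (hU : MeasuredBoolAlg.IsNonprincipal U),
    (MeasuredBoolAlg.measureAlgebra μ ρ hρ).IsWeaklyContainedIn {s.limitAction hπ U hU}

end Soficity

section Bernoulli

open MeasureTheory

/-- The shift action of a group `E` on `{0,1}^E`, given by `(g x)(h) = x(g⁻¹ h)`. -/
def bernoulliShift (E : Type v) [Group E] : E →* Equiv.Perm (E → Bool) where
  toFun g :=
    { toFun := fun x h => x (g⁻¹ * h)
      invFun := fun x h => x (g * h)
      left_inv := fun x => by funext h; simp
      right_inv := fun x => by funext h; simp }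
  map_one' := by ext x h; simp
  map_mul' a b := by ext x h; simp [mul_assoc]

/-- The product measure on `{0,1}^E` of the uniform measure on `{0,1}`. -/
noncomputable def bernoulliMeasure (E : Type v) : Measure (E → Bool) :=
  Measure.infinitePi fun _ : E => (PMF.uniformOfFintype Bool).toMeasure

instance (E : Type v) : IsProbabilityMeasure (bernoulliMeasure E) := by
  unfold bernoulliMeasure
  infer_instance

theorem measurePreserving_bernoulliShift (E : Type v) [Group E] (g : E) :
    MeasurePreserving (bernoulliShift E g) (bernoulliMeasure E) (bernoulliMeasure E) := by
  refine ⟨measurable_pi_lambda _ fun h => measurable_pi_apply _, ?_⟩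
  have h := Measure.infinitePi_map_piCongrLeft
    (μ := fun _ : E => (PMF.uniformOfFintype Bool).toMeasure) (Equiv.mulLeft g)
  have h' : ⇑(MeasurableEquiv.piCongrLeft (fun _ : E => Bool) (Equiv.mulLeft g))
      = bernoulliShift E g := by
    funext x k
    obtain ⟨k, rfl⟩ := (Equiv.mulLeft g).surjective k
    rw [MeasurableEquiv.coe_piCongrLeft, Equiv.piCongrLeft_apply_apply]
    simp [bernoulliShift]
  rw [h'] at h
  exact h

variable {N : Type w} {E : Type v} {Γ : Type u} [Group N] [Group E] [Group Γ]
  (S : GroupExtension N E Γ)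

/-- Two points of `{0,1}^E` are equivalent if they lie in the same orbit of the kernel `N` of the
extension `1 → N → E → Γ → 1`. -/
def bernoulliOrbit : Setoid (E → Bool) where
  r x y := ∃ n : N, bernoulliShift E (S.inl n) x = y
  iseqv :=
    { refl := fun x => ⟨1, by simp⟩
      symm := by
        rintro x _ ⟨n, rfl⟩
        exact ⟨n⁻¹, by simp⟩
      trans := by
        rintro x _ _ ⟨n, rfl⟩ ⟨n', rfl⟩
        exact ⟨n' * n, by simp⟩ }

/-- The quotient space `{0,1}^E / N`. -/
abbrev BernoulliQuotient : Type v := Quotient (bernoulliOrbit S)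

/-- The push-forward to `{0,1}^E / N` of the product measure on `{0,1}^E`. -/
noncomputable def bernoulliQuotientMeasure : Measure (BernoulliQuotient S) :=
  (bernoulliMeasure E).map (Quotient.mk (bernoulliOrbit S))

instance : IsProbabilityMeasure (bernoulliQuotientMeasure S) :=
  Measure.isProbabilityMeasure_map (measurable_quotient_mk'' (s := bernoulliOrbit S)).aemeasurable

theorem bernoulliShift_congr (g : E) {x y : E → Bool} (h : bernoulliOrbit S x y) :
    bernoulliOrbit S (bernoulliShift E g x) (bernoulliShift E g y) := by
  obtain ⟨n, rfl⟩ := h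
  obtain ⟨n', hn'⟩ := S.normal_inl_range.conj_mem (S.inl n) ⟨n, rfl⟩ g
  exact ⟨n', by rw [hn']; simp⟩

/-- The action of `E` on `{0,1}^E / N`. -/
def bernoulliQuotientShift : E →* Equiv.Perm (BernoulliQuotient S) where
  toFun g :=
    { toFun := Quotient.map (bernoulliShift E g) fun _ _ h => bernoulliShift_congr S g h
      invFun := Quotient.map (bernoulliShift E g⁻¹) fun _ _ h => bernoulliShift_congr S g⁻¹ h
      left_inv := fun a => by
        induction a using Quotient.inductionOn
        simp
      right_inv := fun a => by
        induction a using Quotient.inductionOn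
        simp }
  map_one' := by
    ext a
    induction a using Quotient.inductionOn
    simp
  map_mul' g h := by
    ext a
    induction a using Quotient.inductionOn
    simp

/-- The action of `Γ = E / N` on `{0,1}^E / N`. -/
noncomputable def bernoulliQuotientAction : Γ →* Equiv.Perm (BernoulliQuotient S) :=
  S.rightHom.liftOfSurjective S.rightHom_surjective ⟨bernoulliQuotientShift S, fun g hg => by
    rw [← S.range_inl_eq_ker_rightHom] at hg
    obtain ⟨n, rfl⟩ := hg
    ext a
    induction a using Quotient.inductionOn
    rename_i x
    exact (Quotient.sound (s := bernoulliOrbit S) ⟨n, rfl⟩ :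
      Quotient.mk (bernoulliOrbit S) x = _).symm⟩

theorem bernoulliQuotientAction_apply (g : E) (x : E → Bool) :
    bernoulliQuotientAction S (S.rightHom g) (Quotient.mk (bernoulliOrbit S) x) =
      Quotient.mk (bernoulliOrbit S) (bernoulliShift E g x) := by
  unfold bernoulliQuotientAction
  rw [MonoidHom.liftOfRightInverse_comp_apply]
  rfl

theorem measurePreserving_bernoulliQuotientAction (γ : Γ) :
    MeasurePreserving (bernoulliQuotientAction S γ) (bernoulliQuotientMeasure S)
      (bernoulliQuotientMeasure S) := by
  obtain ⟨g, rfl⟩ := S.rightHom_surjective γ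
  have hq : Measurable (Quotient.mk (bernoulliOrbit S)) := measurable_quotient_mk''
  have hcomp : ⇑(bernoulliQuotientAction S (S.rightHom g)) ∘ Quotient.mk (bernoulliOrbit S) =
      Quotient.mk (bernoulliOrbit S) ∘ bernoulliShift E g := by
    funext x
    exact bernoulliQuotientAction_apply S g x
  have hm : Measurable (bernoulliQuotientAction S (S.rightHom g)) := by
    refine measurable_from_quotient.2 ?_
    exact hcomp ▸ hq.comp (measurePreserving_bernoulliShift E g).measurable
  refine ⟨hm, ?_⟩
  unfold bernoulliQuotientMeasure
  rw [Measure.map_map hm hq, hcomp,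
    ← Measure.map_map hq (measurePreserving_bernoulliShift E g).measurable,
    (measurePreserving_bernoulliShift E g).map_eq]

end Bernoulli

section StepFunctions

/-- For a Boolean algebra `P` and a finite abelian group `A`, the group `P(A)` of finite formal sums
`∑ X_a ⊗ a` with `X_a ∈ P` and `a ∈ A`, modulo
`X ⊗ a + Y ⊗ b = (X \ Y) ⊗ a + (Y \ X) ⊗ b + (X ∩ Y) ⊗ (a + b)`. Each element has a unique
normal form `∑_{a ≠ 0} X_a ⊗ a` with pairwise disjoint `X_a`; the elements are encoded by this normal
form, to which the complement `X_0` of the union of the `X_a`, `a ≠ 0`, is added: the family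
`(X_a)_{a ∈ A}` is a partition of `1`. -/
@[ext]
structure StepFun (P : Type v) [BooleanAlgebra P] (A : Type w) [Fintype A] where
  part : A → P
  disjoint : ∀ a b, a ≠ b → Disjoint (part a) (part b)
  sup_eq_top : Finset.univ.sup part = ⊤

namespace StepFun

variable {P : Type v} [BooleanAlgebra P] {A : Type w} [Fintype A]

theorem ext_of_le {x y : StepFun P A} (h : ∀ a, x.part a ≤ y.part a) : x = y := by
  ext a
  refine le_antisymm (h a) ?_
  rw [← inf_top_eq (y.part a), ← x.sup_eq_top, Finset.sup_inf_distrib_left]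
  refine Finset.sup_le fun b _ => ?_
  by_cases hb : a = b
  · rw [hb]; exact inf_le_right
  · exact ((inf_le_inf_left _ (h b)).trans (y.disjoint a b hb).le_bot).trans bot_le

variable [AddCommGroup A]

open Classical in
/-- `0` is the partition with `X_0 = 1`. -/
noncomputable instance : Zero (StepFun P A) where
  zero :=
    { part := fun a => if a = 0 then ⊤ else ⊥
      disjoint := fun a b h => by
        by_cases ha : a = 0
        · rw [if_neg (fun hb => h (ha.trans hb.symm) : b ≠ 0)]; exact disjoint_bot_right
        · rw [if_neg ha]; exact disjoint_bot_left
      sup_eq_top := top_le_iff.1 (by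
        refine le_trans ?_ (Finset.le_sup (Finset.mem_univ (0 : A)))
        rw [if_pos rfl]) }

/-- `(x + y)_c = ⋃_{a + b = c} x_a ∩ y_b`. -/
instance : Add (StepFun P A) where
  add x y :=
    { part := fun c => Finset.univ.sup fun a => x.part a ⊓ y.part (c - a)
      disjoint := fun c c' h => by
        refine Finset.disjoint_sup_left.2 fun a _ => Finset.disjoint_sup_right.2 fun a' _ => ?_
        by_cases haa : a = a'
        · subst haa
          exact (y.disjoint _ _ fun h' => h (sub_left_injective h')).mono inf_le_right inf_le_right
        · exact (x.disjoint _ _ haa).mono inf_le_left inf_le_left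
      sup_eq_top := by
        refine top_le_iff.1 ?_
        rw [← inf_top_eq (⊤ : P)]
        nth_rewrite 1 [← x.sup_eq_top]
        rw [← y.sup_eq_top, Finset.sup_inf_sup]
        refine Finset.sup_le fun p _ => ?_
        refine le_trans ?_ (Finset.le_sup (Finset.mem_univ (p.1 + p.2)))
        refine le_trans ?_ (Finset.le_sup (Finset.mem_univ p.1))
        rw [add_sub_cancel_left] }

/-- `(-x)_a = x_{-a}`. -/
instance : Neg (StepFun P A) where
  neg x :=
    { part := fun a => x.part (-a)
      disjoint := fun a b h => x.disjoint _ _ fun h' => h (neg_injective h')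
      sup_eq_top := by
        refine top_le_iff.1 ?_
        rw [← x.sup_eq_top]
        refine Finset.sup_le fun a _ => ?_
        refine le_trans ?_ (Finset.le_sup (Finset.mem_univ (-a)))
        rw [neg_neg] }

theorem inf_le_add (x y : StepFun P A) {a b c : A} (h : a + b = c) :
    x.part a ⊓ y.part b ≤ (x + y).part c := by
  refine le_trans ?_ (Finset.le_sup (f := fun a => x.part a ⊓ y.part (c - a)) (Finset.mem_univ a))
  rw [← h, add_sub_cancel_left]

theorem add_le {x y : StepFun P A} {c : A} {T : P}
    (h : ∀ a b, a + b = c → x.part a ⊓ y.part b ≤ T) : (x + y).part c ≤ T :=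
  Finset.sup_le fun a _ => h a (c - a) (add_sub_cancel a c)

theorem zero_part_of_ne {a : A} (h : a ≠ 0) : (0 : StepFun P A).part a = ⊥ := if_neg h

theorem zero_part_zero : (0 : StepFun P A).part 0 = ⊤ := if_pos rfl

protected theorem add_comm (x y : StepFun P A) : x + y = y + x :=
  ext_of_le fun c => add_le fun a b h => by
    rw [inf_comm]; exact inf_le_add y x ((add_comm b a).trans h)

noncomputable instance : AddCommGroup (StepFun P A) where
  add_assoc x y z := ext_of_le fun c => add_le fun d e h => by
    rw [← le_himp_iff]
    refine add_le fun a b h' => ?_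
    rw [le_himp_iff, inf_assoc]
    refine (inf_le_inf_left _ (inf_le_add y z rfl)).trans (inf_le_add x (y + z) ?_)
    rw [← add_assoc, h', h]
  zero_add x := ext_of_le fun c => add_le fun a b h => by
    by_cases ha : a = 0
    · subst ha
      rw [zero_add] at h
      rw [h]
      exact inf_le_right
    · rw [zero_part_of_ne ha]
      exact inf_le_left.trans bot_le
  add_zero x := ext_of_le fun c => add_le fun a b h => by
    by_cases hb : b = 0
    · subst hb
      rw [add_zero] at h
      rw [h]
      exact inf_le_left
    · rw [zero_part_of_ne hb]
      exact inf_le_right.trans bot_le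
  neg_add_cancel x := ext_of_le fun c => add_le fun a b h => by
    by_cases hc : c = 0
    · rw [hc, zero_part_zero]
      exact le_top
    · refine ((x.disjoint (-a) b fun h' => hc ?_).le_bot).trans bot_le
      rw [← h, ← h', add_neg_cancel]
  add_comm := StepFun.add_comm
  nsmul := nsmulRec
  zsmul := zsmulRec

end StepFun

namespace MeasuredBoolAlg

variable {Γ : Type u} [Group Γ] (P : MeasuredBoolAlg.{u, v} Γ) (A : Type w) [Fintype A]
  [AddCommGroup A]

/-- The `ℤΓ`-module `P(A)` of a measured `Γ`-Boolean algebra `P`. -/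
def Coeff : Type (max v w) := StepFun P.carrier A

noncomputable instance : AddCommGroup (P.Coeff A) :=
  inferInstanceAs (AddCommGroup (StepFun P.carrier A))

variable {P A}

/-- The action of `g` on `P(A)`, given by `g (∑ X_a ⊗ a) = ∑ (g X_a) ⊗ a`. -/
def coeffMap (g : Γ) (x : P.Coeff A) : P.Coeff A where
  part a := P.act g (x.part a)
  disjoint a b h := by
    have := (x.disjoint a b h).map_orderIso (P.act g)
    exact this
  sup_eq_top := by
    have h := congrArg (P.act g) x.sup_eq_top
    rw [map_top, map_finset_sup] at h
    exact h

noncomputable instance : DistribMulAction Γ (P.Coeff A) where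
  smul := coeffMap
  one_smul x := StepFun.ext (funext fun a => by
    change P.act 1 _ = _
    rw [map_one]; rfl)
  mul_smul g h x := StepFun.ext (funext fun a => by
    change P.act (g * h) _ = P.act g (P.act h _)
    rw [map_mul]; rfl)
  smul_zero g := StepFun.ext_of_le fun c => by
    by_cases hc : c = 0
    · rw [hc]
      exact le_top.trans StepFun.zero_part_zero.ge
    · change P.act g (StepFun.part (0 : StepFun P.carrier A) c) ≤ _
      rw [StepFun.zero_part_of_ne hc, map_bot]
      exact bot_le
  smul_add g x y := StepFun.ext_of_le fun c => by
    change P.act g (Finset.univ.sup fun a => x.part a ⊓ y.part (c - a)) ≤ _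
    rw [map_finset_sup]
    refine Finset.sup_le fun a _ => ?_
    change P.act g (x.part a ⊓ y.part (c - a)) ≤ _
    rw [map_inf]
    exact StepFun.inf_le_add (coeffMap g x) (coeffMap g y) (add_sub_cancel a c)

open Classical in
/-- The length `μ(x) = ∑_{a ≠ 0} μ(X_a)` of `x = ∑_{a ≠ 0} X_a ⊗ a ∈ P(A)`. -/
noncomputable def coeffLength (x : P.Coeff A) : ℝ :=
  ∑ a ∈ Finset.univ.filter (fun a : A => a ≠ 0), P.μ (x.part a)

end MeasuredBoolAlg

end StepFunctions

section Complexes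

/-- The geometric realization of an abstract simplicial complex: finitely supported families of
barycentric coordinates whose support is a face. -/
def Realization {V : Type v} (K : AbstractSimplicialComplex V) : Type v :=
  {x : V →₀ ℝ // (∀ v, 0 ≤ x v) ∧ (x.sum fun _ r => r) = 1 ∧ x.support ∈ K.faces}

/-- The weak topology of the geometric realization: a set is open if and only if its intersection
with each closed simplex `{x | supp x ⊆ s}` is open for the Euclidean topology of the simplex. -/
instance {V : Type v} (K : AbstractSimplicialComplex V) : TopologicalSpace (Realization K) :=
  ⨆ s ∈ K.faces, TopologicalSpace.coinduced
    (Subtype.val : {x : Realization K // x.1.support ⊆ s} → Realization K)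
    (TopologicalSpace.induced (fun x (v : V) => x.1.1 v) Pi.topologicalSpace)

/-- The translate `g s` of a finite set `s`. -/
def translateFinset {Γ : Type u} [Group Γ] {V : Type v} [MulAction Γ V] (g : Γ) (s : Finset V) :
    Finset V :=
  s.map (MulAction.toPerm g).toEmbedding

/-- A finite model for the classifying space `BΓ`: a contractible simplicial complex `EΓ` with
vertex set `V` and a simplicial action of `Γ` which is free (on the geometric realization, i.e. no
simplex is mapped to itself by a non-trivial element) and has only finitely many orbits of
simplices; `BΓ = EΓ / Γ`. -/
structure FiniteClassifyingSpace (Γ : Type u) [Group Γ] (V : Type v) [MulAction Γ V] where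
  complex : AbstractSimplicialComplex V
  translate_mem : ∀ g : Γ, ∀ s ∈ complex.faces, translateFinset g s ∈ complex.faces
  free : ∀ g : Γ, ∀ s ∈ complex.faces, translateFinset g s = s → g = 1
  contractible : ContractibleSpace (Realization complex)
  finite : ∃ T : Set (Finset V), T.Finite ∧
    ∀ s ∈ complex.faces, ∃ t ∈ T, ∃ g : Γ, s = translateFinset g t

namespace FiniteClassifyingSpace

variable {Γ : Type u} [Group Γ] {V : Type v} [MulAction Γ V] (E : FiniteClassifyingSpace Γ V)

/-- The `i`-simplices of `EΓ` with an ordering of their vertices. -/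
structure OrdSimplex (i : ℕ) where
  vertex : Fin (i + 1) → V
  injective : Function.Injective vertex
  mem : Finset.univ.map ⟨vertex, injective⟩ ∈ E.complex.faces

namespace OrdSimplex

variable {E} {i : ℕ}

/-- The underlying simplex. -/
def toFinset (v : E.OrdSimplex i) : Finset V := Finset.univ.map ⟨v.vertex, v.injective⟩

/-- Permuting the vertices. -/
def perm (v : E.OrdSimplex i) (τ : Equiv.Perm (Fin (i + 1))) : E.OrdSimplex i where
  vertex := v.vertex ∘ τ
  injective := v.injective.comp τ.injective
  mem := by
    have h : Finset.univ.map ⟨v.vertex ∘ τ, v.injective.comp τ.injective⟩ = v.toFinset := by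
      ext x
      simp only [toFinset, Finset.mem_map, Finset.mem_univ, true_and,
        Function.Embedding.coeFn_mk, Function.comp_apply]
      exact (τ.surjective.exists (p := fun k => v.vertex k = x)).symm
    exact h ▸ v.mem

/-- The face opposite to the `j`-th vertex. -/
def face (v : E.OrdSimplex (i + 1)) (j : Fin (i + 2)) : E.OrdSimplex i where
  vertex := v.vertex ∘ j.succAbove
  injective := v.injective.comp Fin.succAbove_right_injective
  mem := by
    refine (E.complex.isRelLowerSet_faces v.mem).2 ?_ ⟨v.vertex (j.succAbove 0), by simp⟩
    intro x
    simp only [Finset.mem_map, Finset.mem_univ, true_and, Function.Embedding.coeFn_mk,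
      Function.comp_apply]
    rintro ⟨k, rfl⟩
    exact ⟨_, rfl⟩

/-- The translate of an ordered simplex. -/
def smul (g : Γ) (v : E.OrdSimplex i) : E.OrdSimplex i where
  vertex k := g • v.vertex k
  injective := (MulAction.injective g).comp v.injective
  mem := by
    have h := E.translate_mem g _ v.mem
    rw [translateFinset, Finset.map_map] at h
    exact h

instance : SMul Γ (E.OrdSimplex i) := ⟨smul⟩

theorem smul_vertex (g : Γ) (v : E.OrdSimplex i) (k : Fin (i + 1)) :
    (g • v).vertex k = g • v.vertex k := rfl

theorem toFinset_smul (g : Γ) (v : E.OrdSimplex i) :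
    (g • v).toFinset = translateFinset g v.toFinset := by
  rw [translateFinset, toFinset, toFinset, Finset.map_map]
  rfl

end OrdSimplex

theorem translateFinset_one (s : Finset V) : translateFinset (1 : Γ) s = s := by
  ext; simp [translateFinset]

theorem translateFinset_mul (g h : Γ) (s : Finset V) :
    translateFinset (g * h) s = translateFinset g (translateFinset h s) := by
  rw [translateFinset, translateFinset, translateFinset, Finset.map_map]
  congr 1
  ext x
  simp [mul_smul]

theorem translateFinset_inv_of_eq {g : Γ} {s t : Finset V} (h : s = translateFinset g t) :
    translateFinset g⁻¹ s = t := by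
  rw [h, ← translateFinset_mul, inv_mul_cancel, translateFinset_one]

/-- Two ordered simplices are equivalent if the underlying simplices lie in the same orbit. -/
def cellSetoid (i : ℕ) : Setoid (E.OrdSimplex i) where
  r v w := ∃ g : Γ, w.toFinset = translateFinset g v.toFinset
  iseqv :=
    { refl := fun v => ⟨1, (translateFinset_one _).symm⟩
      symm := by
        rintro v w ⟨g, h⟩
        exact ⟨g⁻¹, by rw [h, ← translateFinset_mul, inv_mul_cancel, translateFinset_one]⟩
      trans := by
        rintro v w x ⟨g, h⟩ ⟨g', h'⟩
        exact ⟨g' * g, by rw [h', h, translateFinset_mul]⟩ }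

/-- The set `BΓ(i)` of `i`-simplices of `BΓ`. -/
def Cell (i : ℕ) : Type v := Quotient (E.cellSetoid i)

instance (i : ℕ) : Finite (E.Cell i) := by
  obtain ⟨T, hT, h⟩ := E.finite
  have := hT.to_subtype
  choose t ht g hg using h
  refine Finite.of_injective (β := T)
    (fun c => ⟨t c.out.toFinset c.out.mem, ht _ _⟩) fun c c' hcc => ?_
  have h1 := hg c.out.toFinset c.out.mem
  have h2 := hg c'.out.toFinset c'.out.mem
  rw [← Subtype.mk.inj hcc] at h2
  rw [← Quotient.out_eq c, ← Quotient.out_eq c']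
  refine Quotient.sound ⟨g c'.out.toFinset c'.out.mem * (g c.out.toFinset c.out.mem)⁻¹, ?_⟩
  rw [translateFinset_mul]
  exact h2.trans (congrArg _ (translateFinset_inv_of_eq h1).symm)

noncomputable instance (i : ℕ) : Fintype (E.Cell i) := Fintype.ofFinite _

variable (M : Type w) [AddCommGroup M] [DistribMulAction Γ M]

/-- The cochain group `C^i(BΓ, M) = Hom_{ℤΓ}(C_i(EΓ), M)` with respect to oriented simplicial
chains: alternating, `Γ`-equivariant functions on the ordered `i`-simplices of `EΓ`. -/
def cochains (i : ℕ) : AddSubgroup (E.OrdSimplex i → M) where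
  carrier := {c | (∀ v (τ : Equiv.Perm (Fin (i + 1))),
      c (v.perm τ) = (Equiv.Perm.sign τ : ℤ) • c v) ∧ ∀ (g : Γ) v, c (g • v) = g • c v}
  zero_mem' := ⟨fun v τ => by simp, fun g v => by simp⟩
  add_mem' := fun {c c'} hc hc' => ⟨fun v τ => by simp [hc.1, hc'.1], fun g v => by
    simp [hc.2, hc'.2]⟩
  neg_mem' := fun {c} hc => ⟨fun v τ => by simp [hc.1], fun g v => by simp [hc.2]⟩

/-- For a permutation `τ` of `{0, …, n + 1}`, the permutation of `{0, …, n}` that is induced by `τ`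
on the complements of `j` and `τ j` has sign `(-1)^(j + τ j) sign τ`. -/
theorem exists_perm_succAbove {n : ℕ} (τ : Equiv.Perm (Fin (n + 1))) (j : Fin (n + 1)) :
    ∃ τ' : Equiv.Perm (Fin n), (∀ k, τ (j.succAbove k) = (τ j).succAbove (τ' k)) ∧
      ((-1) ^ (j : ℕ) * (Equiv.Perm.sign τ' : ℤ)) =
        (Equiv.Perm.sign τ : ℤ) * (-1) ^ (τ j : ℕ) := by
  obtain ⟨⟨p, τ'⟩, h⟩ := Equiv.Perm.decomposeFin.symm.surjective
    ((τ j).cycleRange * τ * j.cycleRange⁻¹)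
  have hp : p = 0 := by
    have h0 := congrArg (fun ρ : Equiv.Perm (Fin (n + 1)) => ρ 0) h
    simpa [Equiv.Perm.inv_def] using h0
  subst hp
  refine ⟨τ', fun k => ?_, ?_⟩
  · have hk := congrArg (fun ρ : Equiv.Perm (Fin (n + 1)) => ρ k.succ) h
    simp only [Equiv.Perm.decomposeFin_symm_apply_succ, Equiv.swap_self, Equiv.refl_apply,
      Equiv.Perm.mul_apply, Equiv.Perm.inv_def, Fin.cycleRange_symm_succ] at hk
    apply (τ j).cycleRange.injective
    rw [← hk, Fin.cycleRange_succAbove]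
  · have hs := congrArg (fun ρ => (Equiv.Perm.sign ρ : ℤ)) h
    simp only [Equiv.Perm.decomposeFin.symm_sign, if_true, one_mul, map_mul, map_inv,
      Fin.sign_cycleRange, Units.val_mul, Units.val_pow_eq_pow_val, Units.val_neg,
      Units.val_one, Int.units_inv_eq_self] at hs
    rw [hs]
    have hj : ((-1 : ℤ) ^ (j : ℕ)) * (-1) ^ (j : ℕ) = 1 := by
      rw [← mul_pow]; simp
    linear_combination ((-1 : ℤ) ^ (τ j : ℕ) * (Equiv.Perm.sign τ : ℤ)) * hj

/-- The differential `(δ c)(v_0, …, v_{i+1}) = ∑_j (-1)^j c(v_0, …, v̂_j, …, v_{i+1})`. -/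
def differential (i : ℕ) : E.cochains M i →+ E.cochains M (i + 1) where
  toFun c := ⟨fun v => ∑ j : Fin (i + 2), ((-1) ^ (j : ℕ) : ℤ) • c.1 (v.face j), by
    refine ⟨fun v τ => ?_, fun g v => ?_⟩
    · rw [Finset.smul_sum, ← Equiv.sum_comp τ]
      refine Finset.sum_congr rfl fun j _ => ?_
      obtain ⟨τ', h1, h2⟩ := exists_perm_succAbove τ j
      have h3 : (v.perm τ).face j = (v.face (τ j)).perm τ' := by
        have : ((v.perm τ).face j).vertex = ((v.face (τ j)).perm τ').vertex := by
          funext k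
          exact congrArg v.vertex (h1 k)
        cases h : (v.perm τ).face j
        cases h' : (v.face (τ j)).perm τ'
        rw [h, h'] at this
        cases this
        rfl
      rw [h3, c.2.1, smul_smul, smul_smul, h2]
    · rw [Finset.smul_sum]
      refine Finset.sum_congr rfl fun j _ => ?_
      rw [smul_comm g, ← c.2.2]
      rfl⟩
  map_zero' := by ext v; simp
  map_add' c c' := by ext v; simp [Finset.sum_add_distrib]

/-- The group `Z^i(BΓ, M)` of cocycles. -/
def cocycles (i : ℕ) : AddSubgroup (E.cochains M i) := (E.differential M i).ker

/-- The group `B^i(BΓ, M)` of coboundaries. -/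
def coboundaries : ∀ i : ℕ, AddSubgroup (E.cochains M i)
  | 0 => ⊥
  | i + 1 => (E.differential M i).range

/-- The cohomology group `H^i(BΓ, M) = Z^i(BΓ, M) / B^i(BΓ, M)`. -/
abbrev Cohomology (i : ℕ) : Type (max v w) :=
  E.cocycles M i ⧸ (E.coboundaries M i).addSubgroupOf (E.cocycles M i)

variable {E}

/-- `ν` is a faithful probability measure on the finite set `BΓ(i)`. -/
def IsFaithfulProbability {i : ℕ} (ν : E.Cell i → ℝ) : Prop :=
  (∀ x, 0 < ν x) ∧ ∑ x, ν x = 1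

universe x

variable {P : MeasuredBoolAlg.{u, x} Γ} {A : Type w} [Fintype A] [AddCommGroup A]

/-- The length `‖c‖ = ∑_{x ∈ BΓ(i)} μ(c(x)) ν(x)` of a cochain `c ∈ C^i(BΓ, P(A))`; for each cell
an ordered simplex of `EΓ` over it is chosen, the choice of which does not matter. -/
noncomputable def cochainLength {i : ℕ} (ν : E.Cell i → ℝ) (c : E.cochains (P.Coeff A) i) : ℝ :=
  ∑ x : E.Cell i, MeasuredBoolAlg.coeffLength (c.1 x.out) * ν x

/-- The quotient length on `H^i(BΓ, P(A))`: the infimum of the lengths of the cocycles that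
represent the class. -/
noncomputable def classLength {i : ℕ} (ν : E.Cell i → ℝ) (α : E.Cohomology (P.Coeff A) i) : ℝ :=
  ⨅ z : {z : E.cocycles (P.Coeff A) i // QuotientAddGroup.mk z = α}, cochainLength ν z.1.1

/-- `Γ` satisfies a cosystolic inequality in dimension `i` with respect to the family `F` of measured
`Γ`-Boolean algebras and the finite abelian group `A`: there is `ε > 0` such that all non-zero classes
in `H^i(BΓ, P(A))`, for all `P` in `F`, have length at least `ε`. -/
def SatisfiesCosystolicInequality (E : FiniteClassifyingSpace Γ V) (i : ℕ) (ν : E.Cell i → ℝ)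
    (F : Set (MeasuredBoolAlg.{u, 0} Γ)) (A : Type w) [Fintype A] [AddCommGroup A] : Prop :=
  ∃ ε : ℝ, 0 < ε ∧ ∀ P ∈ F, ∀ α : E.Cohomology (P.Coeff A) i, α ≠ 0 → ε ≤ classLength ν α

end FiniteClassifyingSpace

end Complexes

-- The extension is encoded by a simplicial 2-cocycle `β` on `BΓ` with values in `A`, and `A` embeds
-- as constants in every module `P(A)`. The quantity to follow is how far `β` is from being a
-- coboundary over `P(A)`: `IsNearlyExact` says that `‖β - δb‖ < ε` for some 1-cochain `b` with
-- values in `P(A)`. A sofic approximation would carry near exactness from the Bernoulli quotient to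
-- a finite transitive action, where it contradicts the failure of residual finiteness.
--
-- At the Bernoulli end, `β` is exact up to null sets (`isNearlyExact_bernoulli`). Since `Γ` is
-- infinite, `A` acts essentially freely on `{0,1}^Γ'`, so there is a measurable map `φ` to `A` that
-- is `A`-equivariant on the free part, that is, a trivialization of the principal `A`-bundle over
-- the orbit space. If `l v` are lifts to `Γ'` of group elements attached equivariantly to the
-- vertices, and `c` is the resulting `A`-valued function on edges with `δc = β`, then `φ(l_v⁻¹ x) -
-- φ(l_w⁻¹ x) + c(v, w)` is invariant under `A` and equivariant under `Γ`. Its coboundary is `β`,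
-- because the terms in `φ` telescope around a triangle.
--
-- Near exactness is passed on in three ways. Measure-preserving equivariant homomorphisms push `b`
-- forward and preserve length. For an ultraproduct, `b` lifts to the product because `Γ` acts
-- freely on edges, and its length is the limit of the lengths of the coordinates, so some factor is
-- nearly exact with the same `ε`. For a finite action, length is a weighted average over transitive
-- actions on orbits of atoms, so one of these orbits is nearly exact. Soficity and stability thus
-- lead from the Bernoulli quotient through a limit action and a finite action to a finite
-- transitive action.
--
-- There the cosystolic inequality makes `β` exactly a coboundary (`exists_differential_eq`).
-- Evaluation at a point with stabilizer `L` turns the primitive into an `L`-invariant primitive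
-- with values in `A`, as in Shapiro's lemma. Correcting the lifts of the edges by it gives a
-- 1-cocycle on the contractible complex with values in the nonabelian group `Γ'`; its potential
-- yields a splitting `L → Γ'` (`exists_splitting`). As `L` has finite index and `A` is finite,
-- residual finiteness of `Γ` passes to `Γ'`, a contradiction.

universe x y z

/-! ### Nonabelian 1-cocycles on a contractible simplicial complex -/

section Topology

namespace Realization

variable {V : Type v} {K : AbstractSimplicialComplex V}

theorem isOpen_iff {U : Set (Realization K)} :
    IsOpen U ↔ ∀ s ∈ K.faces, @IsOpen _ (TopologicalSpace.induced
      (fun (x : {x : Realization K // x.1.support ⊆ s}) (v : V) => x.1.1 v)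
      Pi.topologicalSpace) (Subtype.val ⁻¹' U) := by
  change @IsOpen _ (⨆ s ∈ K.faces, _) U ↔ _
  simp only [isOpen_iSup_iff, isOpen_coinduced]

/-- The open star of a vertex. -/
def openStar (v : V) : Set (Realization K) := {x | 0 < x.1 v}

theorem isOpen_openStar (v : V) : IsOpen (openStar v : Set (Realization K)) := by
  refine isOpen_iff.2 fun s _ => ?_
  exact ⟨{y | 0 < y v}, isOpen_lt continuous_const (continuous_apply v), rfl⟩

theorem mem_support {x : Realization K} {v : V} (h : x ∈ openStar v) : v ∈ x.1.support :=
  Finsupp.mem_support_iff.2 (ne_of_gt h)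

theorem exists_mem_openStar (x : Realization K) : ∃ v, x ∈ openStar v := by
  obtain ⟨v, hv⟩ := (K.isRelLowerSet_faces x.2.2.2).1
  exact ⟨v, lt_of_le_of_ne (x.2.1 v) (Finsupp.mem_support_iff.1 hv).symm⟩

/-- A vertex as a point of the geometric realization. -/
noncomputable def vertexPoint (v : V) : Realization K :=
  ⟨Finsupp.single v 1, fun w => by
    classical
    rw [Finsupp.single_apply]
    split_ifs <;> norm_num, by simp, by
      rw [Finsupp.support_single v one_ne_zero]
      exact K.singleton_mem v⟩

theorem vertexPoint_mem (v : V) : (vertexPoint v : Realization K) ∈ openStar v := by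
  change 0 < (Finsupp.single v 1 : V →₀ ℝ) v
  rw [Finsupp.single_eq_same]
  exact one_pos

/-- A function on the vertices that is constant along the faces is constant if the geometric
realization is connected. -/
theorem eq_of_eq_on_faces [PreconnectedSpace (Realization K)] {T : Type w} (f : V → T)
    (hf : ∀ s ∈ K.faces, ∀ v ∈ s, ∀ w ∈ s, f v = f w) (v w : V) : f v = f w := by
  -- `f` takes one value on the vertices of the face carrying `x`, so `f (i x)` does not depend on
  -- the chosen star and is locally constant in `x`.
  choose i hi using exists_mem_openStar (K := K)
  have key (x : Realization K) (v : V) (hx : x ∈ openStar v) : f (i x) = f v :=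
    hf _ x.2.2.2 _ (mem_support (hi x)) _ (mem_support hx)
  have hloc : IsLocallyConstant fun x => f (i x) := by
    refine (IsLocallyConstant.iff_exists_open _).2 fun x => ?_
    exact ⟨_, isOpen_openStar (i x), hi x, fun y hy => key y _ hy⟩
  rw [← key _ v (vertexPoint_mem v), ← key _ w (vertexPoint_mem w)]
  exact hloc.apply_eq_of_isPreconnected isPreconnected_univ (Set.mem_univ _) (Set.mem_univ _)

/-- The point `(1 - r) v + r w` on an edge. -/
noncomputable def edgePoint {v w : V} (hvw : v ≠ w)
    (h : ({v, w} : Set V).toFinite.toFinset ∈ K.faces)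
    (r : unitInterval) : Realization K :=
  ⟨Finsupp.single v (1 - (r : ℝ)) + Finsupp.single w (r : ℝ), by
    classical
    intro u
    rw [Finsupp.add_apply, Finsupp.single_apply, Finsupp.single_apply]
    have h0 := r.2.1
    have h1 := r.2.2
    split_ifs <;> linarith, by
    rw [Finsupp.sum_add_index' (fun _ => rfl) (fun _ _ _ => rfl), Finsupp.sum_single_index rfl,
      Finsupp.sum_single_index rfl]
    ring, by
    classical
    refine (K.isRelLowerSet_faces h).2 (fun u hu => ?_) ?_
    · simp only [Set.Finite.mem_toFinset, Set.mem_insert_iff, Set.mem_singleton_iff]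
      by_contra! hu'
      refine Finsupp.mem_support_iff.1 hu ?_
      rw [Finsupp.add_apply, Finsupp.single_eq_of_ne hu'.1, Finsupp.single_eq_of_ne hu'.2,
        add_zero]
    · rw [Finsupp.support_nonempty_iff]
      intro h0
      have hv := DFunLike.congr_fun h0 v
      have hw := DFunLike.congr_fun h0 w
      simp only [Finsupp.add_apply, Finsupp.single_eq_same, Finsupp.single_eq_of_ne hvw,
        Finsupp.single_eq_of_ne hvw.symm, Finsupp.coe_zero, Pi.zero_apply] at hv hw
      linarith⟩

/-- The edge stays inside one closed simplex, on which the weak topology is tested by Euclidean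
coordinates. -/
theorem continuous_edgePoint {v w : V} (hvw : v ≠ w)
    (h : ({v, w} : Set V).toFinite.toFinset ∈ K.faces) :
    Continuous (edgePoint hvw h) := by
  classical
  refine continuous_def.2 fun U hU => ?_
  obtain ⟨W, hW, hWU⟩ := isOpen_iff.1 hU _ h
  have hs (r : unitInterval) : (edgePoint hvw h r).1.support ⊆
      ({v, w} : Set V).toFinite.toFinset := by
    intro u hu
    simp only [Set.Finite.mem_toFinset, Set.mem_insert_iff, Set.mem_singleton_iff]
    by_contra! hu'
    refine Finsupp.mem_support_iff.1 hu ?_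
    change (Finsupp.single v _ + Finsupp.single w _ : V →₀ ℝ) u = 0
    rw [Finsupp.add_apply, Finsupp.single_eq_of_ne hu'.1, Finsupp.single_eq_of_ne hu'.2, add_zero]
  have heq : edgePoint hvw h ⁻¹' U =
      (fun (r : unitInterval) (u : V) => (edgePoint hvw h r).1 u) ⁻¹' W := by
    ext r
    exact (Set.ext_iff.1 hWU ⟨edgePoint hvw h r, hs r⟩).symm
  rw [heq]
  refine hW.preimage (continuous_pi fun u => ?_)
  change Continuous fun r : unitInterval =>
    (Finsupp.single v (1 - (r : ℝ)) + Finsupp.single w (r : ℝ) : V →₀ ℝ) u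
  simp only [Finsupp.add_apply, Finsupp.single_apply]
  refine Continuous.add ?_ ?_
  · split_ifs <;> fun_prop
  · split_ifs <;> fun_prop

theorem edgePoint_mem_left {v w : V} (hvw : v ≠ w)
    (h : ({v, w} : Set V).toFinite.toFinset ∈ K.faces) {r : unitInterval} (hr : r < 1) :
    edgePoint hvw h r ∈ openStar v := by
  change 0 < (Finsupp.single v (1 - (r : ℝ)) + Finsupp.single w (r : ℝ) : V →₀ ℝ) v
  rw [Finsupp.add_apply, Finsupp.single_eq_same, Finsupp.single_eq_of_ne hvw, add_zero]
  have : (r : ℝ) < 1 := hr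
  linarith

theorem edgePoint_mem_right {v w : V} (hvw : v ≠ w)
    (h : ({v, w} : Set V).toFinite.toFinset ∈ K.faces) {r : unitInterval} (hr : 0 < r) :
    edgePoint hvw h r ∈ openStar w := by
  change 0 < (Finsupp.single v (1 - (r : ℝ)) + Finsupp.single w (r : ℝ) : V →₀ ℝ) w
  rw [Finsupp.add_apply, Finsupp.single_eq_same, Finsupp.single_eq_of_ne hvw.symm, zero_add]
  exact hr

theorem edgePoint_zero {v w : V} (hvw : v ≠ w)
    (h : ({v, w} : Set V).toFinite.toFinset ∈ K.faces) : edgePoint hvw h 0 = vertexPoint v :=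
  Subtype.ext (by simp [edgePoint, vertexPoint])

theorem edgePoint_one {v w : V} (hvw : v ≠ w)
    (h : ({v, w} : Set V).toFinite.toFinset ∈ K.faces) : edgePoint hvw h 1 = vertexPoint w :=
  Subtype.ext (by simp [edgePoint, vertexPoint])

/-- The principal bundle with discrete fibre over the geometric realization that is defined by a
1-cocycle on the vertices. -/
noncomputable def bundleCore {G : Type w} [Group G] [TopologicalSpace G] [DiscreteTopology G]
    (t : V → V → G)
    (ht : ∀ s ∈ K.faces, ∀ u ∈ s, ∀ v ∈ s, ∀ w ∈ s, t u v * t v w = t u w) :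
    FiberBundleCore V (Realization K) G where
  baseSet := openStar
  isOpen_baseSet := isOpen_openStar
  indexAt x := (exists_mem_openStar x).choose
  mem_baseSet_at x := (exists_mem_openStar x).choose_spec
  coordChange v w _ g := g * t v w
  coordChange_self v x hx g := by
    have h := ht _ x.2.2.2 v (mem_support hx) v (mem_support hx) v (mem_support hx)
    rw [mul_eq_left.1 h, mul_one]
  continuousOn_coordChange v w :=
    ((continuous_of_discreteTopology (f := fun g : G => g * t v w)).comp
      continuous_snd).continuousOn
  coordChange_comp u v w x hx g := by
    rw [mul_assoc, ht _ x.2.2.2 u (mem_support hx.1.1) v (mem_support hx.1.2) w (mem_support hx.2)]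

/-- Every 1-cocycle on a contractible simplicial complex with coefficients in a discrete group is
a coboundary. -/
theorem exists_potential [ContractibleSpace (Realization K)] {G : Type w} [Group G]
    (t : V → V → G)
    (ht : ∀ s ∈ K.faces, ∀ u ∈ s, ∀ v ∈ s, ∀ w ∈ s, t u v * t v w = t u w) :
    ∃ θ : V → G, ∀ s ∈ K.faces, ∀ v ∈ s, ∀ w ∈ s, θ v * t v w = θ w := by
  -- With discrete fibres the bundle glued from the cocycle is a covering, so homotopies lift.
  let : TopologicalSpace G := ⊥
  have : DiscreteTopology G := ⟨rfl⟩
  let Z := bundleCore t ht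
  have hcov : IsCoveringMap Z.proj := IsFiberBundle.isCoveringMap fun x =>
    ⟨Z.localTriv (Z.indexAt x), Z.mem_baseSet_at x⟩
  -- The reversed contraction runs from the constant map at `p` to the identity. Its lift, started
  -- at a point `e` over `p`, is at time `1` a global section of the covering.
  obtain ⟨p, ⟨H⟩⟩ := id_nullhomotopic (Realization K)
  let e : Z.TotalSpace := ⟨p, (1 : G)⟩
  let L := hcov.liftHomotopy H.symm.toContinuousMap (ContinuousMap.const _ e)
    (fun a => H.symm.apply_zero a)
  have hs (x : Realization K) : Z.proj (L (1, x)) = x :=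
    (congrFun (hcov.liftHomotopy_lifts _ _ _) (1, x)).trans (H.symm.apply_one x)
  -- The section read in the chart over the star of `v`; the potential is its value at the vertex
  -- `v`.
  let c (v : V) (x : Realization K) : G := ((Z.localTriv v) (L (1, x))).2
  have hc (v : V) : ContinuousOn (c v) (openStar v) := by
    refine continuous_snd.comp_continuousOn ((Z.localTriv v).continuousOn.comp
      (L.continuous.comp (Continuous.prodMk_right 1)).continuousOn fun x hx => ?_)
    refine (Z.localTriv v).mem_source.2 ?_
    rw [hs]
    exact hx
  have htriv (v w : V) (z : Z.TotalSpace) (hv : z.proj ∈ openStar v) (hw : z.proj ∈ openStar w) :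
      ((Z.localTriv v z).2 : G) * t v w = (Z.localTriv w z).2 :=
    Z.coordChange_comp _ v w z.proj ⟨⟨Z.mem_baseSet_at _, hv⟩, hw⟩ z.2
  have hcvw (v w : V) (x : Realization K) (hv : x ∈ openStar v) (hw : x ∈ openStar w) :
      c v x * t v w = c w x :=
    htriv v w (L (1, x)) (by rw [← hs x] at hv; exact hv) (by rw [← hs x] at hw; exact hw)
  refine ⟨fun v => c v (vertexPoint v), fun s hsK v hv w hw => ?_⟩
  by_cases hvw : v = w
  · subst hvw
    rw [mul_eq_left.1 (ht s hsK v hv v hv v hv), mul_one]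
  have he : ({v, w} : Set V).toFinite.toFinset ∈ K.faces := by
    refine (K.isRelLowerSet_faces hsK).2 (fun u hu => ?_) ⟨v, by simp⟩
    simp only [Set.Finite.mem_toFinset, Set.mem_insert_iff, Set.mem_singleton_iff] at hu
    rcases hu with rfl | rfl
    exacts [hv, hw]
  -- The edge without its end `w` lies in the star of `v`, and without `v` in the star of `w`. Each
  -- chart value is constant on its half-open edge, and at the interior point `r` the two differ by
  -- the transition function `t v w`.
  obtain ⟨r, hr0, hr1⟩ := exists_between (zero_lt_one (α := unitInterval))
  have hv' : c v (edgePoint hvw he 0) = c v (edgePoint hvw he r) :=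
    isPreconnected_Iio.constant (s := Set.Iio (1 : unitInterval))
      ((hc v).comp (continuous_edgePoint hvw he).continuousOn
        fun r hr => edgePoint_mem_left hvw he hr) (Set.mem_Iio.2 zero_lt_one) (Set.mem_Iio.2 hr1)
  have hw' : c w (edgePoint hvw he r) = c w (edgePoint hvw he 1) :=
    isPreconnected_Ioi.constant (s := Set.Ioi (0 : unitInterval))
      ((hc w).comp (continuous_edgePoint hvw he).continuousOn
        fun r hr => edgePoint_mem_right hvw he hr) (Set.mem_Ioi.2 hr0) (Set.mem_Ioi.2 zero_lt_one)
  rw [edgePoint_zero] at hv'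
  rw [edgePoint_one] at hw'
  change c v _ * _ = c w _
  rw [hv', ← hw', hcvw v w _ (edgePoint_mem_left hvw he hr1) (edgePoint_mem_right hvw he hr0)]

end Realization

end Topology

/-! ### Functoriality of the modules `P(A)` -/

section Coefficients

namespace StepFun

variable {P : Type v} [BooleanAlgebra P] {Q : Type w} [BooleanAlgebra Q] {A : Type x} [Fintype A]
  [AddCommGroup A]

/-- The homomorphism of coefficient groups that is induced by a homomorphism of Boolean
algebras. -/
def map (f : BoundedLatticeHom P Q) : StepFun P A →+ StepFun Q A where
  toFun x :=
    { part := fun a => f (x.part a)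
      disjoint := fun a b h => by
        rw [disjoint_iff, ← map_inf, (x.disjoint a b h).eq_bot, map_bot]
      sup_eq_top := by
        have h := congrArg f x.sup_eq_top
        rwa [map_top, map_finset_sup] at h }
  map_zero' := ext_of_le fun c => by
    by_cases hc : c = 0
    · rw [hc, zero_part_zero]
      exact le_top
    · change f ((0 : StepFun P A).part c) ≤ _
      rw [zero_part_of_ne hc, map_bot]
      exact bot_le
  map_add' x y := ext_of_le fun c => by
    change f (Finset.univ.sup fun a => x.part a ⊓ y.part (c - a)) ≤
      Finset.univ.sup fun a => f (x.part a) ⊓ f (y.part (c - a))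
    rw [map_finset_sup]
    exact Finset.sup_mono_fun fun a _ => (map_inf f _ _).le

theorem map_part (f : BoundedLatticeHom P Q) (x : StepFun P A) (a : A) :
    (map f x).part a = f (x.part a) := rfl

open Classical in
/-- The constant step function. -/
noncomputable def const : A →+ StepFun P A where
  toFun b :=
    { part := fun a => if a = b then ⊤ else ⊥
      disjoint := fun a c h => by
        by_cases ha : a = b
        · rw [if_neg (fun hb => h (ha.trans hb.symm) : c ≠ b)]; exact disjoint_bot_right
        · rw [if_neg ha]; exact disjoint_bot_left
      sup_eq_top := top_le_iff.1 (by
        refine le_trans ?_ (Finset.le_sup (Finset.mem_univ b))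
        rw [if_pos rfl]) }
  map_zero' := rfl
  map_add' b c := ext_of_le fun d => by
    by_cases hd : d = b + c
    · refine le_trans ?_ (inf_le_add _ _ hd.symm)
      simp
    · exact (if_neg hd).trans_le bot_le

open Classical in
theorem const_part (b a : A) : (const b : StepFun P A).part a = if a = b then ⊤ else ⊥ := rfl

theorem map_const (f : BoundedLatticeHom P Q) (b : A) : map f (const b) = const b :=
  StepFun.ext (funext fun a => by
    rw [map_part, const_part, const_part]
    split_ifs <;> simp)

end StepFun

namespace MeasuredBoolAlg

variable {Γ : Type u} [Group Γ] {P : MeasuredBoolAlg.{u, v} Γ} {Q : MeasuredBoolAlg.{u, w} Γ}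
  {A : Type x} [Fintype A] [AddCommGroup A]

/-- The homomorphism of coefficient groups that is induced by an equivariant homomorphism of
measured Boolean algebras. -/
def mapCoeff (f : BoundedLatticeHom P.carrier Q.carrier)
    (hf : ∀ g X, f (P.act g X) = Q.act g (f X)) : P.Coeff A →+[Γ] Q.Coeff A where
  __ := (StepFun.map f : StepFun P.carrier A →+ StepFun Q.carrier A)
  map_smul' g x := StepFun.ext (funext fun a => hf g (x.part a))

variable (P) in
/-- The inclusion of the trivial module `A` into `P(A)`. -/
noncomputable def constCoeff [DistribMulAction Γ A] (hA : ∀ (g : Γ) (a : A), g • a = a) :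
    A →+[Γ] P.Coeff A where
  __ := (StepFun.const : A →+ StepFun P.carrier A)
  map_smul' g a := by
    rw [hA]
    refine StepFun.ext (funext fun b => ?_)
    change StepFun.part (StepFun.const a) b = P.act g (StepFun.part (StepFun.const a) b)
    rw [StepFun.const_part]
    split_ifs <;> simp

theorem mapCoeff_constCoeff [DistribMulAction Γ A] (hA : ∀ (g : Γ) (a : A), g • a = a)
    (f : BoundedLatticeHom P.carrier Q.carrier) (hf : ∀ g X, f (P.act g X) = Q.act g (f X))
    (a : A) : mapCoeff f hf (constCoeff P hA a) = constCoeff Q hA a :=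
  StepFun.map_const f a

theorem coeffLength_nonneg (x : P.Coeff A) : 0 ≤ coeffLength x :=
  Finset.sum_nonneg fun _ _ => P.μ_nonneg _

theorem coeffLength_mapCoeff (f : BoundedLatticeHom P.carrier Q.carrier)
    (hf : ∀ g X, f (P.act g X) = Q.act g (f X)) (hμ : ∀ X, Q.μ (f X) = P.μ X) (x : P.Coeff A) :
    coeffLength (mapCoeff f hf x) = coeffLength x :=
  Finset.sum_congr rfl fun _ _ => hμ _

end MeasuredBoolAlg

end Coefficients

/-! ### Cochains in degrees 1 and 2 as functions on edges -/

section Cochains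

namespace FiniteClassifyingSpace

variable {Γ : Type u} [Group Γ] {V : Type v} [MulAction Γ V] (E : FiniteClassifyingSpace Γ V)

section Map

variable {M : Type w} [AddCommGroup M] [DistribMulAction Γ M]
  {N : Type x} [AddCommGroup N] [DistribMulAction Γ N]

/-- The map of cochain groups that is induced by a homomorphism of coefficients. -/
def mapCochains (φ : M →+[Γ] N) (i : ℕ) : E.cochains M i →+ E.cochains N i where
  toFun c := ⟨fun v => φ (c.1 v),
    fun v τ => (congrArg φ (c.2.1 v τ)).trans (map_zsmul φ _ _),
    fun g v => (congrArg φ (c.2.2 g v)).trans (map_smul φ _ _)⟩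
  map_zero' := Subtype.ext (funext fun _ => map_zero φ)
  map_add' _ _ := Subtype.ext (funext fun _ => map_add φ _ _)

theorem differential_mapCochains (φ : M →+[Γ] N) (i : ℕ) (c : E.cochains M i) :
    E.differential N i (E.mapCochains φ i c) = E.mapCochains φ (i + 1) (E.differential M i c) := by
  refine Subtype.ext (funext fun v => ?_)
  change ∑ j : Fin (i + 2), ((-1) ^ (j : ℕ) : ℤ) • φ (c.1 (v.face j)) =
    φ (∑ j : Fin (i + 2), ((-1) ^ (j : ℕ) : ℤ) • c.1 (v.face j))
  rw [map_sum]
  exact Finset.sum_congr rfl fun j _ => (map_zsmul φ _ _).symm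

end Map

section Edges

/-- Two vertices are joined by an edge. -/
def IsEdge (v w : V) : Prop := v ≠ w ∧ ∃ s ∈ E.complex.faces, v ∈ s ∧ w ∈ s

variable {E}

theorem IsEdge.symm {v w : V} (h : E.IsEdge v w) : E.IsEdge w v :=
  ⟨h.1.symm, h.2.imp fun _ hs => ⟨hs.1, hs.2.2, hs.2.1⟩⟩

theorem IsEdge.smul {v w : V} (h : E.IsEdge v w) (g : Γ) : E.IsEdge (g • v) (g • w) := by
  obtain ⟨hvw, s, hs, hv, hw⟩ := h
  refine ⟨(MulAction.injective g).ne hvw, _, E.translate_mem g s hs, ?_, ?_⟩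
  · exact Finset.mem_map.2 ⟨v, hv, rfl⟩
  · exact Finset.mem_map.2 ⟨w, hw, rfl⟩

/-- An edge as an ordered simplex. -/
def IsEdge.toSimplex {v w : V} (h : E.IsEdge v w) : E.OrdSimplex 1 where
  vertex := ![v, w]
  injective := by
    intro i j hij
    fin_cases i <;> fin_cases j <;> first | rfl | exact absurd hij h.1 | exact absurd hij h.1.symm
  mem := by
    obtain ⟨hvw, s, hs, hv, hw⟩ := h
    refine (E.complex.isRelLowerSet_faces hs).2 (fun u hu => ?_)
      ⟨v, Finset.mem_map.2 ⟨0, Finset.mem_univ _, rfl⟩⟩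
    obtain ⟨k, -, rfl⟩ := Finset.mem_map.1 hu
    fin_cases k
    exacts [hv, hw]

theorem IsEdge.mem_toSimplex {v w : V} (h : E.IsEdge v w) {u : V} :
    u ∈ h.toSimplex.toFinset ↔ u = v ∨ u = w := by
  refine Finset.mem_map.trans ⟨?_, ?_⟩
  · rintro ⟨k, -, rfl⟩
    fin_cases k
    exacts [Or.inl rfl, Or.inr rfl]
  · rintro (rfl | rfl)
    exacts [⟨0, Finset.mem_univ _, rfl⟩, ⟨1, Finset.mem_univ _, rfl⟩]

theorem OrdSimplex.ext' {i : ℕ} {v w : E.OrdSimplex i} (h : v.vertex = w.vertex) : v = w := by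
  cases v
  cases w
  cases h
  rfl

theorem OrdSimplex.isEdge {i : ℕ} (x : E.OrdSimplex i) {j k : Fin (i + 1)} (h : j ≠ k) :
    E.IsEdge (x.vertex j) (x.vertex k) :=
  ⟨x.injective.ne h, _, x.mem, by simp, by simp⟩

variable {M : Type w} [AddCommGroup M] [DistribMulAction Γ M]

theorem perm_fin_two (τ : Equiv.Perm (Fin 2)) :
    (τ 0 = 0 ∧ τ 1 = 1 ∧ Equiv.Perm.sign τ = 1) ∨
      (τ 0 = 1 ∧ τ 1 = 0 ∧ Equiv.Perm.sign τ = -1) := by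
  revert τ
  decide

variable (E) in
/-- The 1-cochain that is defined by an alternating and equivariant function on the edges. -/
def edgeCochain (f : V → V → M) (h_symm : ∀ v w, E.IsEdge v w → f w v = - f v w)
    (h_smul : ∀ (g : Γ) v w, E.IsEdge v w → f (g • v) (g • w) = g • f v w) : E.cochains M 1 :=
  ⟨fun x => f (x.vertex 0) (x.vertex 1), fun x τ => by
    change f (x.vertex (τ 0)) (x.vertex (τ 1)) = _
    rcases perm_fin_two τ with ⟨h0, h1, hτ⟩ | ⟨h0, h1, hτ⟩
    · rw [h0, h1, hτ]; simp
    · rw [h0, h1, hτ, h_symm _ _ (x.isEdge zero_ne_one)]; simp, fun g x =>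
    h_smul g _ _ (x.isEdge zero_ne_one)⟩

open Classical in
/-- The value of a 1-cochain on an edge, and `0` on all other pairs of vertices. -/
noncomputable def edgeValue (c : E.cochains M 1) (v w : V) : M :=
  if h : E.IsEdge v w then c.1 h.toSimplex else 0

theorem edgeValue_vertex {i : ℕ} (c : E.cochains M 1) (x : E.OrdSimplex i) {j k : Fin (i + 1)}
    (h : j ≠ k) : edgeValue c (x.vertex j) (x.vertex k) = c.1 (x.isEdge h).toSimplex :=
  dif_pos (x.isEdge h)

theorem edgeValue_symm (c : E.cochains M 1) (v w : V) : edgeValue c w v = - edgeValue c v w := by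
  unfold edgeValue
  by_cases h : E.IsEdge v w
  · rw [dif_pos h, dif_pos h.symm]
    have hx : h.symm.toSimplex = h.toSimplex.perm (Equiv.swap 0 1) :=
      OrdSimplex.ext' (funext fun i => by fin_cases i <;> rfl)
    rw [hx, c.2.1, Equiv.Perm.sign_swap zero_ne_one]
    simp
  · rw [dif_neg h, dif_neg fun h' => h h'.symm, neg_zero]

theorem edgeValue_smul (c : E.cochains M 1) (g : Γ) (v w : V) :
    edgeValue c (g • v) (g • w) = g • edgeValue c v w := by
  unfold edgeValue
  by_cases h : E.IsEdge v w
  · rw [dif_pos h, dif_pos (h.smul g), ← c.2.2]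
    exact congrArg c.1 (OrdSimplex.ext' (funext fun i => by fin_cases i <;> rfl))
  · rw [dif_neg h, dif_neg fun h' => h (by simpa using h'.smul g⁻¹), smul_zero]

theorem edgeCochain_edgeValue (c : E.cochains M 1) :
    E.edgeCochain (edgeValue c) (fun v w _ => edgeValue_symm c v w)
      (fun g v w _ => edgeValue_smul c g v w) = c :=
  Subtype.ext (funext fun x => by
    refine (edgeValue_vertex c x zero_ne_one).trans (congrArg c.1 ?_)
    exact OrdSimplex.ext' (funext fun i => by fin_cases i <;> rfl))

theorem differential_apply_two (c : E.cochains M 1) (x : E.OrdSimplex 2) :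
    (E.differential M 1 c).1 x = edgeValue c (x.vertex 0) (x.vertex 1) +
      edgeValue c (x.vertex 1) (x.vertex 2) + edgeValue c (x.vertex 2) (x.vertex 0) := by
  change ∑ j : Fin 3, ((-1) ^ (j : ℕ) : ℤ) • c.1 (x.face j) = _
  rw [Fin.sum_univ_three, edgeValue_symm c (x.vertex 0) (x.vertex 2),
    edgeValue_vertex c x (by decide : (0 : Fin 3) ≠ 1),
    edgeValue_vertex c x (by decide : (1 : Fin 3) ≠ 2),
    edgeValue_vertex c x (by decide : (0 : Fin 3) ≠ 2)]
  have h0 : x.face 0 = (x.isEdge (by decide : (1 : Fin 3) ≠ 2)).toSimplex :=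
    OrdSimplex.ext' (funext fun i => by fin_cases i <;> rfl)
  have h1 : x.face 1 = (x.isEdge (by decide : (0 : Fin 3) ≠ 2)).toSimplex :=
    OrdSimplex.ext' (funext fun i => by fin_cases i <;> rfl)
  have h2 : x.face 2 = (x.isEdge (by decide : (0 : Fin 3) ≠ 1)).toSimplex :=
    OrdSimplex.ext' (funext fun i => by fin_cases i <;> rfl)
  rw [h0, h1, h2]
  simp
  abel

/-- In the boundary of a tetrahedron each edge occurs twice with opposite signs. Equivariance of `e`
plays no role, so the lemma gives both `δδ = 0` and the cocycle property of `boundaryCochain`, where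
`e` itself is not a cochain. -/
theorem sum_face_eq_zero {N : Type x} [AddCommGroup N] {e : V → V → N}
    (he : ∀ v w, E.IsEdge v w → e w v = - e v w) {c : E.OrdSimplex 2 → N}
    (hc : ∀ y, c y = e (y.vertex 0) (y.vertex 1) +
      e (y.vertex 1) (y.vertex 2) + e (y.vertex 2) (y.vertex 0)) (x : E.OrdSimplex 3) :
    ∑ j : Fin 4, ((-1) ^ (j : ℕ) : ℤ) • c (x.face j) = 0 := by
  have hx (j : Fin 4) (k : Fin 3) : (x.face j).vertex k = x.vertex (j.succAbove k) := rfl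
  have h02 := he _ _ (x.isEdge (by decide : (0 : Fin 4) ≠ 2))
  have h03 := he _ _ (x.isEdge (by decide : (0 : Fin 4) ≠ 3))
  have h13 := he _ _ (x.isEdge (by decide : (1 : Fin 4) ≠ 3))
  rw [Fin.sum_univ_four, hc, hc, hc, hc]
  simp only [hx]
  have s00 : (0 : Fin 4).succAbove (0 : Fin 3) = 1 := by decide
  have s01 : (0 : Fin 4).succAbove (1 : Fin 3) = 2 := by decide
  have s02 : (0 : Fin 4).succAbove (2 : Fin 3) = 3 := by decide
  have s10 : (1 : Fin 4).succAbove (0 : Fin 3) = 0 := by decide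
  have s11 : (1 : Fin 4).succAbove (1 : Fin 3) = 2 := by decide
  have s12 : (1 : Fin 4).succAbove (2 : Fin 3) = 3 := by decide
  have s20 : (2 : Fin 4).succAbove (0 : Fin 3) = 0 := by decide
  have s21 : (2 : Fin 4).succAbove (1 : Fin 3) = 1 := by decide
  have s22 : (2 : Fin 4).succAbove (2 : Fin 3) = 3 := by decide
  have s30 : (3 : Fin 4).succAbove (0 : Fin 3) = 0 := by decide
  have s31 : (3 : Fin 4).succAbove (1 : Fin 3) = 1 := by decide
  have s32 : (3 : Fin 4).succAbove (2 : Fin 3) = 2 := by decide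
  rw [s00, s01, s02, s10, s11, s12, s20, s21, s22, s30, s31, s32, h02, h03, h13]
  simp
  abel

theorem differential_differential (c : E.cochains M 1) :
    E.differential M 2 (E.differential M 1 c) = 0 :=
  Subtype.ext (funext fun x => sum_face_eq_zero (fun v w _ => edgeValue_symm c v w)
    (differential_apply_two c) x)

theorem perm_fin_three (τ : Equiv.Perm (Fin 3)) :
    (τ 0 = 0 ∧ τ 1 = 1 ∧ τ 2 = 2 ∧ Equiv.Perm.sign τ = 1) ∨
    (τ 0 = 1 ∧ τ 1 = 2 ∧ τ 2 = 0 ∧ Equiv.Perm.sign τ = 1) ∨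
    (τ 0 = 2 ∧ τ 1 = 0 ∧ τ 2 = 1 ∧ Equiv.Perm.sign τ = 1) ∨
    (τ 0 = 1 ∧ τ 1 = 0 ∧ τ 2 = 2 ∧ Equiv.Perm.sign τ = -1) ∨
    (τ 0 = 0 ∧ τ 1 = 2 ∧ τ 2 = 1 ∧ Equiv.Perm.sign τ = -1) ∨
    (τ 0 = 2 ∧ τ 1 = 1 ∧ τ 2 = 0 ∧ Equiv.Perm.sign τ = -1) := by
  revert τ
  decide

variable (E) in
/-- The 2-cocycle that is the coboundary of an alternating, not necessarily equivariant, function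
on the edges. -/
def boundaryCochain (e : V → V → M) (he : ∀ v w, E.IsEdge v w → e w v = - e v w)
    (h_smul : ∀ (g : Γ) (x : E.OrdSimplex 2),
      e (g • x.vertex 0) (g • x.vertex 1) + e (g • x.vertex 1) (g • x.vertex 2) +
        e (g • x.vertex 2) (g • x.vertex 0) = g • (e (x.vertex 0) (x.vertex 1) +
        e (x.vertex 1) (x.vertex 2) + e (x.vertex 2) (x.vertex 0))) : E.cochains M 2 :=
  ⟨fun x => e (x.vertex 0) (x.vertex 1) + e (x.vertex 1) (x.vertex 2) +
      e (x.vertex 2) (x.vertex 0), fun x τ => by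
    change e (x.vertex (τ 0)) (x.vertex (τ 1)) + e (x.vertex (τ 1)) (x.vertex (τ 2)) +
      e (x.vertex (τ 2)) (x.vertex (τ 0)) = _
    have h10 := he _ _ (x.isEdge (by decide : (0 : Fin 3) ≠ 1))
    have h21 := he _ _ (x.isEdge (by decide : (1 : Fin 3) ≠ 2))
    have h02 := he _ _ (x.isEdge (by decide : (2 : Fin 3) ≠ 0))
    rcases perm_fin_three τ with ⟨h0, h1, h2, hτ⟩ | ⟨h0, h1, h2, hτ⟩ | ⟨h0, h1, h2, hτ⟩ |
      ⟨h0, h1, h2, hτ⟩ | ⟨h0, h1, h2, hτ⟩ | ⟨h0, h1, h2, hτ⟩ <;>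
    · rw [h0, h1, h2, hτ]
      simp only [h10, h21, h02, Units.val_one, one_smul, Units.val_neg, neg_smul] <;> abel,
    h_smul⟩

theorem boundaryCochain_mem_cocycles {e : V → V → M}
    (he : ∀ v w, E.IsEdge v w → e w v = - e v w)
    (h_smul : ∀ (g : Γ) (x : E.OrdSimplex 2),
      e (g • x.vertex 0) (g • x.vertex 1) + e (g • x.vertex 1) (g • x.vertex 2) +
        e (g • x.vertex 2) (g • x.vertex 0) = g • (e (x.vertex 0) (x.vertex 1) +
        e (x.vertex 1) (x.vertex 2) + e (x.vertex 2) (x.vertex 0))) :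
    E.boundaryCochain e he h_smul ∈ E.cocycles M 2 :=
  Subtype.ext (funext fun x => sum_face_eq_zero he (fun _ => rfl) x)

theorem eq_one_of_smul_eq (E : FiniteClassifyingSpace Γ V) {g : Γ} {v : V} (h : g • v = v) :
    g = 1 :=
  E.free g {v} (E.complex.singleton_mem v) (by simp [translateFinset, h])

/-- A free action admits an equivariant map to the group. -/
theorem exists_equivariant (E : FiniteClassifyingSpace Γ V) :
    ∃ h : V → Γ, ∀ (g : Γ) v, h (g • v) = g * h v := by
  have hr (v : V) : ∃ g : Γ, g • (Quotient.mk (MulAction.orbitRel Γ V) v).out = v :=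
    MulAction.orbitRel_apply.1 ((MulAction.orbitRel Γ V).symm
      (Quotient.mk_out (s := MulAction.orbitRel Γ V) v))
  choose h hh using hr
  refine ⟨h, fun g v => ?_⟩
  have hq : Quotient.mk (MulAction.orbitRel Γ V) (g • v) =
      Quotient.mk (MulAction.orbitRel Γ V) v :=
    Quotient.sound (MulAction.orbitRel_apply.2 ⟨g, rfl⟩)
  have h1 := hh (g • v)
  rw [hq] at h1
  conv_rhs at h1 => rw [← hh v]
  rw [← inv_mul_eq_one]
  refine E.eq_one_of_smul_eq (v := (Quotient.mk (MulAction.orbitRel Γ V) v).out) ?_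
  rw [mul_smul, inv_smul_eq_iff, h1, mul_smul]

variable (E) in
/-- The edges can be oriented in an invariant way. -/
theorem exists_orientation : ∃ o : V → V → Prop,
    (∀ (g : Γ) v w, o (g • v) (g • w) ↔ o v w) ∧ ∀ v w, E.IsEdge v w → (o w v ↔ ¬ o v w) := by
  -- An edge is oriented by comparing the orbits of its two orderings in a well-order on the set of
  -- orbits.
  let q (v w : V) : MulAction.orbitRel.Quotient Γ (V × V) := Quotient.mk _ (v, w)
  have hq (g : Γ) (v w : V) : q (g • v) (g • w) = q v w :=
    Quotient.sound (MulAction.orbitRel_apply.2 ⟨g, rfl⟩)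
  refine ⟨fun v w => WellOrderingRel (q v w) (q w v), fun g v w => by simp only [hq],
    fun v w h => ⟨fun h1 h2 => asymm h1 h2, fun h1 => ?_⟩⟩
  rcases trichotomous_of WellOrderingRel (q v w) (q w v) with h2 | h2 | h2
  · exact absurd h2 h1
  -- Equal orbits would give an element that exchanges `v` and `w`, hence maps the edge to itself.
  -- Freeness on the realization excludes such inversions.
  · obtain ⟨g, hg⟩ := MulAction.orbitRel_apply.1 (Quotient.exact h2)
    have hgw : g • w = v := congrArg Prod.fst hg
    have hgv : g • v = w := congrArg Prod.snd hg
    have hg1 : g = 1 := by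
      refine E.free g _ h.toSimplex.mem ?_
      ext u
      refine Finset.mem_map.trans ⟨?_, fun hu => ?_⟩
      · rintro ⟨u, hu, rfl⟩
        rcases h.mem_toSimplex.1 hu with rfl | rfl
        exacts [h.mem_toSimplex.2 (Or.inr hgv), h.mem_toSimplex.2 (Or.inl hgw)]
      · rcases h.mem_toSimplex.1 hu with rfl | rfl
        exacts [⟨w, h.mem_toSimplex.2 (Or.inr rfl), hgw⟩, ⟨v, h.mem_toSimplex.2 (Or.inl rfl), hgv⟩]
    rw [hg1, one_smul] at hgv
    exact absurd hgv h.1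
  · exact h2

/-- Surjections of coefficients induce surjections of 1-cochains. -/
theorem mapCochains_one_surjective {N : Type x} [AddCommGroup N] [DistribMulAction Γ N]
    (φ : M →+[Γ] N) (hφ : Function.Surjective φ) :
    Function.Surjective (E.mapCochains φ 1) := by
  intro c
  obtain ⟨h, hh⟩ := E.exists_equivariant
  obtain ⟨o, ho_smul, ho_symm⟩ := E.exists_orientation
  obtain ⟨l, hl⟩ := hφ.hasRightInverse
  -- The set-theoretic section `l` is not equivariant, so it is applied only after moving `v` to its
  -- orbit representative, and the result is moved back.
  let m (v w : V) : M := h v • l (edgeValue c ((h v)⁻¹ • v) ((h v)⁻¹ • w))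
  have hm_smul (g : Γ) (v w : V) : m (g • v) (g • w) = g • m v w := by
    simp only [m, hh, mul_inv_rev, mul_smul, inv_smul_smul]
  have hm (v w : V) : φ (m v w) = edgeValue c v w := by
    simp only [m, map_smul]
    rw [hl, ← edgeValue_smul, smul_inv_smul, smul_inv_smul]
  classical
  -- The lift `m` is equivariant but need not be alternating; an invariant orientation keeps one of
  -- the two values on each edge.
  let f (v w : V) : M := if o v w then m v w else - m w v
  have hf (v w : V) : φ (f v w) = edgeValue c v w := by
    simp only [f]
    split_ifs
    · exact hm v w
    · rw [map_neg, hm, edgeValue_symm, neg_neg]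
  refine ⟨E.edgeCochain f (fun v w hvw => ?_) (fun g v w _ => ?_), ?_⟩
  · simp only [f, ho_symm v w hvw]
    by_cases h1 : o v w
    · rw [if_neg (not_not.2 h1), if_pos h1]
    · rw [if_pos h1, if_neg h1, neg_neg]
  · simp only [f, ho_smul, hm_smul]
    split_ifs <;> simp
  · rw [← edgeCochain_edgeValue c]
    exact Subtype.ext (funext fun x => hf _ _)

end Edges

end FiniteClassifyingSpace

end Cochains

/-! ### Near exactness: containment, ultraproducts and the cosystolic inequality -/

section NearlyExact

/-- Arbitrary preimages of the parts need not be disjoint or cover `⊤`. Removing from each the union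
of the others repairs disjointness without changing the image. -/
theorem StepFun.map_surjective {P : Type v} [BooleanAlgebra P] {Q : Type w} [BooleanAlgebra Q]
    {A : Type x} [Fintype A] [AddCommGroup A] (f : BoundedLatticeHom P Q)
    (hf : Function.Surjective f) : Function.Surjective (StepFun.map f : StepFun P A → _) := by
  classical
  intro y
  choose X hX using fun a => hf (y.part a)
  let Y (a : A) : P := X a \ (Finset.univ.filter (· ≠ a)).sup X
  -- The part at `0` absorbs everything that the other parts leave uncovered.
  let Z (a : A) : P := if a = 0 then ((Finset.univ.filter (· ≠ (0 : A))).sup Y)ᶜ else Y a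
  have hYY (a b : A) (h : a ≠ b) : Disjoint (Y a) (Y b) := by
    refine Disjoint.mono sdiff_le le_rfl
      (disjoint_sdiff_self_right.mono_right (sdiff_le_sdiff_left ?_) : Disjoint (X a) (Y b))
    exact Finset.le_sup (by simpa using h)
  have hYZ (a : A) (h : a ≠ 0) : Disjoint (Y a) (Z 0) := by
    simp only [Z, if_true]
    exact disjoint_compl_right.mono_left (Finset.le_sup (f := Y) (by simpa using h))
  have hdisj (a b : A) (h : a ≠ b) : Disjoint (Z a) (Z b) := by
    by_cases ha : a = 0
    · subst ha
      have hb : Z b = Y b := if_neg h.symm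
      rw [hb]
      exact (hYZ b h.symm).symm
    · have ha' : Z a = Y a := if_neg ha
      rw [ha']
      by_cases hb : b = 0
      · subst hb
        exact hYZ a ha
      · have hb' : Z b = Y b := if_neg hb
        rw [hb']
        exact hYY a b h
  refine ⟨⟨Z, hdisj, ?_⟩, ?_⟩
  · rw [← top_le_iff, ← sup_compl_eq_top (x := (Finset.univ.filter (· ≠ (0 : A))).sup Y)]
    refine sup_le (Finset.sup_le fun a ha => ?_) ?_
    · have ha' : Z a = Y a := if_neg (by simpa using ha)
      exact ha' ▸ Finset.le_sup (Finset.mem_univ a)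
    · have h0 : Z 0 = ((Finset.univ.filter (· ≠ (0 : A))).sup Y)ᶜ := if_pos rfl
      exact h0 ▸ Finset.le_sup (Finset.mem_univ 0)
  -- Partitions of `⊤` that are comparable part by part coincide, so one inequality suffices.
  · refine (StepFun.ext_of_le fun a => ?_).symm
    change y.part a ≤ f (Z a)
    have hfY (b : A) : f (Y b) ≤ y.part b := hX b ▸ OrderHomClass.mono f sdiff_le
    by_cases ha : a = 0
    · subst ha
      simp only [Z, if_true]
      rw [map_compl', map_finset_sup, le_compl_iff_disjoint_right, Finset.disjoint_sup_right]
      exact fun b hb => (y.disjoint 0 b (by simpa using (Finset.mem_filter.1 hb).2.symm)).mono_right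
        (hfY b)
    · have ha' : Z a = Y a := if_neg ha
      rw [ha', map_sdiff', map_finset_sup, le_sdiff, hX]
      refine ⟨le_rfl, Finset.disjoint_sup_right.2 fun b hb => ?_⟩
      rw [Function.comp_apply, hX]
      exact y.disjoint a b (by simpa using (Finset.mem_filter.1 hb).2.symm)

namespace MeasuredBoolAlg

variable {Γ : Type u} [Group Γ]

/-- The quotient homomorphism to the reduced measured Boolean algebra. -/
def mkHom (P : MeasuredBoolAlg.{u, v} Γ) : BoundedLatticeHom P.carrier P.reduced.carrier where
  toFun := Reduced.mk
  map_sup' _ _ := rfl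
  map_inf' _ _ := rfl
  map_top' := rfl
  map_bot' := rfl

theorem mkHom_act (P : MeasuredBoolAlg.{u, v} Γ) (g : Γ) (X : P.carrier) :
    P.mkHom (P.act g X) = P.reduced.act g (P.mkHom X) := rfl

theorem isContainedIn_reduced (P : MeasuredBoolAlg.{u, v} Γ) : P.IsContainedIn P.reduced :=
  ⟨P.mkHom, fun _ => rfl, P.mkHom_act⟩

/-- The coordinate homomorphisms of a product of measured Boolean algebras. -/
def projHom {I : Type w} (U : Ultrafilter I) (P : I → MeasuredBoolAlg.{u, v} Γ) (j : I) :
    BoundedLatticeHom (limProd U P).carrier (P j).carrier where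
  toFun X := X j
  map_sup' _ _ := rfl
  map_inf' _ _ := rfl
  map_top' := rfl
  map_bot' := rfl

theorem projHom_act {I : Type w} (U : Ultrafilter I) (P : I → MeasuredBoolAlg.{u, v} Γ) (j : I)
    (g : Γ) (X : (limProd U P).carrier) :
    projHom U P j ((limProd U P).act g X) = (P j).act g (projHom U P j X) := rfl

end MeasuredBoolAlg

namespace FiniteClassifyingSpace

open MeasuredBoolAlg

variable {Γ : Type u} [Group Γ] {V : Type v} [MulAction Γ V] (E : FiniteClassifyingSpace Γ V)
  {A : Type w} [Fintype A] [AddCommGroup A]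

theorem cochainLength_mapCochains {P : MeasuredBoolAlg.{u, x} Γ} {Q : MeasuredBoolAlg.{u, y} Γ}
    {i : ℕ} (ν : E.Cell i → ℝ) (f : BoundedLatticeHom P.carrier Q.carrier)
    (hf : ∀ g X, f (P.act g X) = Q.act g (f X)) (hμ : ∀ X, Q.μ (f X) = P.μ X)
    (c : E.cochains (P.Coeff A) i) :
    cochainLength ν (E.mapCochains (mapCoeff f hf) i c) = cochainLength ν c :=
  Finset.sum_congr rfl fun x _ =>
    congrArg (· * ν x) (coeffLength_mapCoeff f hf hμ (c.1 x.out))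

theorem cochainLength_nonneg {P : MeasuredBoolAlg.{u, x} Γ} {i : ℕ} {ν : E.Cell i → ℝ}
    (hν : ∀ x, 0 ≤ ν x) (c : E.cochains (P.Coeff A) i) : 0 ≤ cochainLength ν c :=
  Finset.sum_nonneg fun x _ => mul_nonneg (coeffLength_nonneg _) (hν x)

-- The length is a finite sum over cells and elements of `A` of measures, each of which is by
-- definition a limit along `U`. The coordinate maps do not preserve measure, so only the limit of
-- the coordinate lengths can be compared with the length in the product.
variable {E} in
theorem tendsto_cochainLength {I : Type z} (U : Ultrafilter I) (Q : I → MeasuredBoolAlg.{u, x} Γ)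
    {i : ℕ} (ν : E.Cell i → ℝ) (c : E.cochains ((limProd U Q).Coeff A) i) :
    Filter.Tendsto (fun j => cochainLength ν
      (E.mapCochains (mapCoeff (projHom U Q j) (projHom_act U Q j)) i c)) U
      (nhds (cochainLength ν c)) :=
  tendsto_finsetSum _ fun _ _ => Filter.Tendsto.mul_const _ <|
    tendsto_finsetSum _ fun _ _ => tendsto_limUnder U (fun j => (Q j).μ_nonneg _)
      fun j => (Q j).μ_le_one _

variable [DistribMulAction Γ A] (hA : ∀ (g : Γ) (a : A), g • a = a)

/-- The difference of a constant cochain and a coboundary. -/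
noncomputable def defect (P : MeasuredBoolAlg.{u, x} Γ) (β : E.cochains A 2)
    (b : E.cochains (P.Coeff A) 1) : E.cochains (P.Coeff A) 2 :=
  E.mapCochains (constCoeff P hA) 2 β - E.differential (P.Coeff A) 1 b

theorem mapCochains_defect {P : MeasuredBoolAlg.{u, x} Γ} {Q : MeasuredBoolAlg.{u, y} Γ}
    (f : BoundedLatticeHom P.carrier Q.carrier) (hf : ∀ g X, f (P.act g X) = Q.act g (f X))
    (β : E.cochains A 2) (b : E.cochains (P.Coeff A) 1) :
    E.mapCochains (mapCoeff f hf) 2 (E.defect hA P β b) =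
      E.defect hA Q β (E.mapCochains (mapCoeff f hf) 1 b) := by
  unfold defect
  rw [map_sub, differential_mapCochains]
  congr 1
  exact Subtype.ext (funext fun v => mapCoeff_constCoeff hA f hf _)

/-- The class of a cochain with constant coefficients has small length in `P(A)`. -/
def IsNearlyExact (ν : E.Cell 2 → ℝ) (β : E.cochains A 2) (ε : ℝ) (P : MeasuredBoolAlg.{u, x} Γ) :
    Prop :=
  ∃ b : E.cochains (P.Coeff A) 1, cochainLength ν (E.defect hA P β b) < ε

variable {E hA} {ν : E.Cell 2 → ℝ} {β : E.cochains A 2} {ε : ℝ}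

theorem IsNearlyExact.of_isContainedIn {P : MeasuredBoolAlg.{u, x} Γ}
    {Q : MeasuredBoolAlg.{u, y} Γ} (h : E.IsNearlyExact hA ν β ε P) (hPQ : P.IsContainedIn Q) :
    E.IsNearlyExact hA ν β ε Q := by
  obtain ⟨b, hb⟩ := h
  obtain ⟨f, hμ, hf⟩ := hPQ
  refine ⟨E.mapCochains (mapCoeff f hf) 1 b, ?_⟩
  rwa [← mapCochains_defect, cochainLength_mapCochains E ν f hf hμ]

/-- A 1-cochain over the quotient lifts to a strictly equivariant one over `P`, by
`mapCochains_one_surjective`. The lift has a defect of the same length, since the quotient map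
preserves measure. -/
theorem IsNearlyExact.of_reduced {P : MeasuredBoolAlg.{u, x} Γ}
    (h : E.IsNearlyExact hA ν β ε P.reduced) : E.IsNearlyExact hA ν β ε P := by
  obtain ⟨b, hb⟩ := h
  obtain ⟨b, rfl⟩ := mapCochains_one_surjective (mapCoeff P.mkHom P.mkHom_act)
    (StepFun.map_surjective P.mkHom Reduced.mk_surjective) b
  refine ⟨b, ?_⟩
  rwa [← mapCochains_defect, cochainLength_mapCochains E ν _ _ fun _ => rfl] at hb

/-- The inequality `< ε` is strict, hence an open condition: it holds for `U`-many coordinates once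
it holds for the limit of the lengths. There is no loss in `ε`. -/
theorem IsNearlyExact.exists_of_ultraproduct {I : Type z} {U : Ultrafilter I}
    {Q : I → MeasuredBoolAlg.{u, x} Γ} (h : E.IsNearlyExact hA ν β ε (ultraproduct U Q)) :
    ∃ j, E.IsNearlyExact hA ν β ε (Q j) := by
  obtain ⟨b, hb⟩ := h.of_reduced
  obtain ⟨j, hj⟩ := ((tendsto_cochainLength U Q ν _).eventually_lt_const hb).exists
  rw [mapCochains_defect] at hj
  exact ⟨j, _, hj⟩

theorem IsNearlyExact.exists_of_isWeaklyContainedIn {P : MeasuredBoolAlg.{u, x} Γ}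
    {F : Set (MeasuredBoolAlg.{u, 0} Γ)} (h : E.IsNearlyExact hA ν β ε P)
    (hPF : P.IsWeaklyContainedIn F) : ∃ Q ∈ F, E.IsNearlyExact hA ν β ε Q := by
  obtain ⟨I, U, Q, -, hQ, hPQ⟩ := hPF
  obtain ⟨j, hj⟩ := (h.of_isContainedIn hPQ).exists_of_ultraproduct
  exact ⟨Q j, hQ j, hj⟩

/-- A cosystolic inequality turns classes of small length into trivial classes. -/
theorem exists_differential_eq (hν : ∀ x, 0 ≤ ν x) {P : MeasuredBoolAlg.{u, 0} Γ}
    (hP : ∀ α : E.Cohomology (P.Coeff A) 2, α ≠ 0 → ε ≤ classLength ν α)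
    (hβ : β ∈ E.cocycles A 2) (h : E.IsNearlyExact hA ν β ε P) :
    ∃ b, E.differential (P.Coeff A) 1 b = E.mapCochains (constCoeff P hA) 2 β := by
  obtain ⟨b, hb⟩ := h
  -- The defect represents the class of `β`, so that class has length less than `ε` and must vanish.
  have hz : E.defect hA P β b ∈ E.cocycles (P.Coeff A) 2 := by
    change E.differential (P.Coeff A) 2 _ = 0
    unfold defect
    rw [map_sub, differential_differential, differential_mapCochains,
      (hβ : E.differential A 2 β = 0), map_zero, sub_zero]
  have h0 : (QuotientAddGroup.mk ⟨_, hz⟩ : E.Cohomology (P.Coeff A) 2) = 0 := by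
    by_contra hne
    refine (hb.trans_le (hP _ hne)).not_ge ?_
    -- An infimum of reals is bounded by its members only for families bounded below; here
    -- nonnegativity of `ν` supplies the bound `0`.
    refine ciInf_le ⟨0, ?_⟩ (⟨⟨_, hz⟩, rfl⟩ : {z : E.cocycles (P.Coeff A) 2 //
      (QuotientAddGroup.mk z : E.Cohomology (P.Coeff A) 2) = QuotientAddGroup.mk ⟨_, hz⟩})
    rintro _ ⟨z, rfl⟩
    exact cochainLength_nonneg E hν _
  obtain ⟨b', hb'⟩ := AddSubgroup.mem_addSubgroupOf.1 ((QuotientAddGroup.eq_zero_iff _).1 h0)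
  refine ⟨b' + b, ?_⟩
  rw [map_add, hb']
  exact sub_add_cancel _ _

end FiniteClassifyingSpace
end NearlyExact

/-! ### Finite actions as averages of transitive ones -/

section FiniteActions

namespace MeasuredBoolAlg

variable {Γ : Type u} [Group Γ] (P : MeasuredBoolAlg.{u, v} Γ)

/-- The type of atoms of a measured Boolean algebra. -/
def Atom : Type v := {a : P.carrier // IsAtom a}

variable {P}

/-- Atoms of a Boolean algebra are prime; this is what makes `orbitHom` preserve suprema. -/
theorem Atom.le_sup_iff (a : P.Atom) {X Y : P.carrier} : a.1 ≤ X ⊔ Y ↔ a.1 ≤ X ∨ a.1 ≤ Y := by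
  refine ⟨fun h => ?_, fun h => h.elim le_sup_of_le_left le_sup_of_le_right⟩
  by_contra! h'
  have h1 := a.2.not_le_iff_disjoint.1 h'.1
  have h2 := a.2.not_le_iff_disjoint.1 h'.2
  exact a.2.1 (disjoint_self.1 ((h1.sup_right h2).mono_right h))

instance : MulAction Γ P.Atom where
  smul g a := ⟨P.act g a.1, (OrderIso.isAtom_iff (P.act g) a.1).2 a.2⟩
  one_smul a := Subtype.ext (by
    change P.act 1 a.1 = a.1
    rw [map_one]; rfl)
  mul_smul g h a := Subtype.ext (by
    change P.act (g * h) a.1 = P.act g (P.act h a.1)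
    rw [map_mul]; rfl)

theorem μ_eq_of_mem_orbit {a b : P.Atom} (h : b ∈ MulAction.orbit Γ a) : P.μ b.1 = P.μ a.1 := by
  obtain ⟨g, rfl⟩ := h
  exact P.μ_act g a.1

instance [Finite P.carrier] : Finite P.Atom := Subtype.finite

theorem μ_finset_sup {ι : Type*} (s : Finset ι) (X : ι → P.carrier)
    (h : ∀ i ∈ s, ∀ j ∈ s, i ≠ j → Disjoint (X i) (X j)) :
    P.μ (s.sup X) = ∑ i ∈ s, P.μ (X i) := by
  classical
  induction s using Finset.induction_on with
  | empty => simpa using P.μ_bot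
  | insert i s hi ih =>
    have hd : X i ⊓ s.sup X = ⊥ := by
      rw [← disjoint_iff, Finset.disjoint_sup_right]
      exact fun j hj => h i (Finset.mem_insert_self _ _) j (Finset.mem_insert_of_mem hj)
        fun hij => hi (hij ▸ hj)
    have h1 := P.μ_sup_add_inf (X i) (s.sup X)
    rw [hd, P.μ_bot, add_zero] at h1
    rw [Finset.sup_insert, Finset.sum_insert hi, h1, ih fun i hi j hj =>
      h i (Finset.mem_insert_of_mem hi) j (Finset.mem_insert_of_mem hj)]

open Classical in
theorem μ_eq_sum_atoms [Finite P.carrier] [Fintype P.Atom] (X : P.carrier) :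
    P.μ X = ∑ a : P.Atom, if a.1 ≤ X then P.μ a.1 else 0 := by
  rw [← Finset.sum_filter, ← μ_finset_sup _ fun a : P.Atom => a.1]
  · congr 1
    refine le_antisymm ?_ (Finset.sup_le fun a ha => (Finset.mem_filter.1 ha).2)
    rw [← sdiff_eq_bot_iff]
    by_contra hne
    obtain ⟨a, ha, hle⟩ := (IsAtomic.eq_bot_or_exists_atom_le _).resolve_left hne
    have h1 : a ≤ (Finset.univ.filter fun a : P.Atom => a.1 ≤ X).sup fun a => a.1 :=
      Finset.le_sup (f := fun a : P.Atom => a.1) (b := ⟨a, ha⟩)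
        (Finset.mem_filter.2 ⟨Finset.mem_univ _, hle.trans sdiff_le⟩)
    exact ha.1 (disjoint_self.1 (disjoint_sdiff_self_left.mono hle h1))
  · exact fun a _ b _ hab => a.2.disjoint_of_ne b.2 fun h => hab (Subtype.ext h)

variable [Finite P.carrier]

instance (a : P.Atom) : Nonempty (MulAction.orbit Γ a) := (MulAction.nonempty_orbit a).to_subtype

/-- The action on the power set of an orbit of atoms. -/
noncomputable def orbitAlg (a : P.Atom) : MeasuredBoolAlg.{u, v} Γ :=
  powerSet (MulAction.orbit Γ a) (MulAction.toPermHom Γ (MulAction.orbit Γ a))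

/-- The restriction to an orbit of atoms. -/
noncomputable def orbitHom (a : P.Atom) : BoundedLatticeHom P.carrier (orbitAlg a).carrier where
  toFun X := {o : MulAction.orbit Γ a | o.1.1 ≤ X}
  map_sup' _ _ := Set.ext fun o => o.1.le_sup_iff
  map_inf' _ _ := Set.ext fun _ => le_inf_iff
  map_top' := Set.ext fun _ => ⟨fun _ => trivial, fun _ => le_top⟩
  map_bot' := Set.ext fun o => ⟨fun h => o.1.2.1 (le_bot_iff.1 h), fun h => h.elim⟩

theorem orbitHom_act (a : P.Atom) (g : Γ) (X : P.carrier) :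
    orbitHom a (P.act g X) = (orbitAlg a).act g (orbitHom a X) := by
  change {o : MulAction.orbit Γ a | o.1.1 ≤ P.act g X} =
    (MulAction.toPerm g : Equiv.Perm (MulAction.orbit Γ a)) ''
      {o : MulAction.orbit Γ a | o.1.1 ≤ X}
  ext o
  rw [Equiv.image_eq_preimage_symm]
  change o.1.1 ≤ P.act g X ↔ P.act g⁻¹ o.1.1 ≤ X
  rw [map_inv]
  exact ((P.act g).symm_apply_le).symm

-- All atoms of an orbit have the same measure, so restricted to an orbit `P.μ` is a multiple of
-- normalized counting measure. Summing over atoms instead of orbits avoids choosing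
-- representatives: an orbit then appears once for each of its atoms, with total weight its measure.
open Classical in
theorem μ_eq_average [Fintype P.Atom] (X : P.carrier) :
    P.μ X = ∑ a : P.Atom, P.μ a.1 * (orbitAlg a).μ (orbitHom a X) := by
  have h1 (a : P.Atom) : P.μ a.1 * (orbitAlg a).μ (orbitHom a X) = ∑ o : P.Atom,
      if o ∈ MulAction.orbit Γ a ∧ o.1 ≤ X then
        P.μ o.1 / Nat.card (MulAction.orbit Γ o) else 0 := by
    have hcard : ({o : MulAction.orbit Γ a | o.1.1 ≤ X}).ncard =
        (Finset.univ.filter fun o : P.Atom => o ∈ MulAction.orbit Γ a ∧ o.1 ≤ X).card := by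
      rw [← Set.ncard_image_of_injective _ Subtype.val_injective, ← Set.ncard_coe_finset]
      congr 1
      ext o
      simp [and_comm]
    change P.μ a.1 * (({o : MulAction.orbit Γ a | o.1.1 ≤ X}).ncard /
      Nat.card (MulAction.orbit Γ a)) = _
    rw [hcard, ← Finset.sum_filter, Finset.card_eq_sum_ones, Nat.cast_sum, Finset.sum_div,
      Finset.mul_sum]
    refine Finset.sum_congr rfl fun o ho => ?_
    have ho' := (Finset.mem_filter.1 ho).2.1
    rw [μ_eq_of_mem_orbit ho', MulAction.orbit_eq_iff.2 ho']
    simp [div_eq_mul_inv]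
  simp only [h1]
  -- After the exchange, an atom `o ≤ X` is counted once for each atom `a` of its orbit, which
  -- cancels the division by the size of the orbit.
  rw [Finset.sum_comm, μ_eq_sum_atoms]
  refine Finset.sum_congr rfl fun o _ => ?_
  by_cases ho : o.1 ≤ X
  · have hcard : (Finset.univ.filter fun a : P.Atom => o ∈ MulAction.orbit Γ a).card =
        Nat.card (MulAction.orbit Γ o) := by
      rw [Nat.card_coe_set_eq, ← Set.ncard_coe_finset]
      congr 1
      ext a
      simp [MulAction.mem_orbit_symm]
    have hpos : (Nat.card (MulAction.orbit Γ o) : ℝ) ≠ 0 := by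
      exact_mod_cast Nat.card_pos.ne'
    simp only [ho, and_true, if_true]
    rw [← Finset.sum_filter, Finset.sum_const, hcard, nsmul_eq_mul]
    field_simp
  · simp [ho]

variable {A : Type w} [Fintype A] [AddCommGroup A]

theorem coeffLength_eq_average [Fintype P.Atom] (y : P.Coeff A) : coeffLength y =
    ∑ a : P.Atom, P.μ a.1 * coeffLength (mapCoeff (orbitHom a) (orbitHom_act a) y) := by
  simp only [coeffLength, Finset.mul_sum]
  rw [Finset.sum_comm]
  exact Finset.sum_congr rfl fun b _ => μ_eq_average _

end MeasuredBoolAlg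

namespace FiniteClassifyingSpace

open MeasuredBoolAlg

variable {Γ : Type u} [Group Γ] {V : Type v} [MulAction Γ V] {E : FiniteClassifyingSpace Γ V}
  {A : Type w} [Fintype A] [AddCommGroup A] [DistribMulAction Γ A]
  {hA : ∀ (g : Γ) (a : A), g • a = a} {ν : E.Cell 2 → ℝ} {β : E.cochains A 2} {ε : ℝ}

/-- The length of the defect is an average, with weights `P.μ a` of sum `1`, of the lengths of its
restrictions to orbits of atoms; these cannot all be at least `ε`. -/
theorem IsNearlyExact.exists_transitive {P : MeasuredBoolAlg.{u, 0} Γ}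
    (hP : P ∈ finiteActions Γ) (h : E.IsNearlyExact hA ν β ε P) :
    ∃ Q ∈ finiteTransitiveActions Γ, E.IsNearlyExact hA ν β ε Q := by
  have hP' : Finite P.carrier := hP
  have := Fintype.ofFinite P.Atom
  obtain ⟨b, hb⟩ := h
  suffices ∃ a : P.Atom, E.IsNearlyExact hA ν β ε (orbitAlg a) by
    obtain ⟨a, ha⟩ := this
    refine ⟨_, ⟨MulAction.orbit Γ a, inferInstance, inferInstance, _, fun x y => ?_, rfl⟩, ha⟩
    exact MulAction.exists_smul_eq Γ x y
  by_contra! hne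
  refine hb.not_ge ?_
  let c (a : P.Atom) := E.mapCochains (mapCoeff (orbitHom a) (orbitHom_act a)) 2 (E.defect hA P β b)
  have hc (a : P.Atom) : ε ≤ cochainLength ν (c a) := by
    by_contra! hlt
    refine hne a ⟨E.mapCochains (mapCoeff (orbitHom a) (orbitHom_act a)) 1 b, ?_⟩
    rwa [← mapCochains_defect]
  have hlen : cochainLength ν (E.defect hA P β b) =
      ∑ a : P.Atom, P.μ a.1 * cochainLength ν (c a) := by
    simp only [cochainLength, Finset.mul_sum]
    rw [Finset.sum_comm]
    refine Finset.sum_congr rfl fun x _ => ?_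
    rw [coeffLength_eq_average, Finset.sum_mul]
    exact Finset.sum_congr rfl fun a _ => mul_assoc _ _ _
  have htop : ∑ a : P.Atom, P.μ a.1 = 1 := by
    rw [← P.μ_top, μ_eq_sum_atoms ⊤]
    simp
  calc ε = ∑ a : P.Atom, P.μ a.1 * ε := by rw [← Finset.sum_mul, htop, one_mul]
    _ ≤ ∑ a : P.Atom, P.μ a.1 * cochainLength ν (c a) :=
      Finset.sum_le_sum fun a _ => mul_le_mul_of_nonneg_left (hc a) (P.μ_nonneg _)
    _ = _ := hlen.symm

end FiniteClassifyingSpace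

end FiniteActions

/-! ### Central extensions: residual finiteness, the cocycle and splittings -/

section Extension

namespace GroupExtension

variable {N : Type w} {G : Type x} {Γ : Type u} [Group N] [Group G] [Group Γ]
  (S : GroupExtension N G Γ)

/-- A coset of `H` is determined by its image in `Γ` modulo the image of `H`, up to finitely many
translations by `N`; hence `N × Γ/(image of H)` maps onto `G/H`. -/
theorem finiteIndex_of_map [Finite N] (H : Subgroup G) (h : (H.map S.rightHom).FiniteIndex) :
    H.FiniteIndex := by
  obtain ⟨l, hl⟩ := S.rightHom_surjective.hasRightInverse
  have : Finite (G ⧸ H) := by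
    refine Finite.of_surjective
      (fun p : N × (Γ ⧸ H.map S.rightHom) => (QuotientGroup.mk (S.inl p.1 * l p.2.out) : G ⧸ H))
      fun q => ?_
    obtain ⟨g, rfl⟩ := QuotientGroup.mk_surjective q
    obtain ⟨⟨_, k, hk, rfl⟩, hk'⟩ := QuotientGroup.mk_out_eq_mul (H.map S.rightHom) (S.rightHom g)
    have hker : g * (l (S.rightHom g * S.rightHom k) * k⁻¹)⁻¹ ∈ S.inl.range := by
      rw [S.range_inl_eq_ker_rightHom, MonoidHom.mem_ker]
      simp [hl (S.rightHom g * S.rightHom k)]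
    obtain ⟨n, hn⟩ := hker
    refine ⟨(n, QuotientGroup.mk (S.rightHom g)), ?_⟩
    change (QuotientGroup.mk (S.inl n * l (QuotientGroup.mk (S.rightHom g)).out) : G ⧸ H) = _
    rw [hk']
    refine QuotientGroup.eq.2 ?_
    have h1 : (S.inl n * l (S.rightHom g * S.rightHom k))⁻¹ * g = k⁻¹ := by
      rw [hn]
      group
    change (S.inl n * l (S.rightHom g * S.rightHom k))⁻¹ * g ∈ H
    rw [h1]
    exact H.inv_mem hk
  exact Subgroup.finiteIndex_of_finite_quotient

/-- An extension of a residually finite group by a finite group that splits over a subgroup of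
finite index is residually finite. -/
theorem residuallyFinite_of_splits [Finite N] (hΓ : Group.ResiduallyFinite Γ) (L : Subgroup Γ)
    [L.FiniteIndex] (s : L →* G) (hs : ∀ g, S.rightHom (s g) = g) : Group.ResiduallyFinite G := by
  -- The group `s(K)` projects onto `K`, which has finite index in `Γ`.
  have hfin (K : Subgroup L) [K.FiniteIndex] : (K.map s).FiniteIndex := by
    refine S.finiteIndex_of_map _ ?_
    have h1 : (K.map s).map S.rightHom = K.map L.subtype := by
      rw [Subgroup.map_map]
      congr 1
      ext g
      exact hs g
    rw [h1]
    exact ⟨by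
      rw [Subgroup.index_map_subtype]
      exact mul_ne_zero Subgroup.FiniteIndex.index_ne_zero Subgroup.FiniteIndex.index_ne_zero⟩
  refine Group.residuallyFinite_iff_exists_finiteIndex.2 fun g hg => ?_
  -- An element outside `s(L)` is excluded by `s(L)` itself. An element `s a` is excluded by `s(K)`,
  -- where `K` has finite index in `L` and does not contain `a`.
  by_cases hgs : g ∈ s.range
  · obtain ⟨a, rfl⟩ := hgs
    have ha : a ≠ 1 := fun h => hg (by rw [h, map_one])
    obtain ⟨K, hK, haK⟩ := Group.residuallyFinite_iff_exists_finiteIndex.1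
      (inferInstance : Group.ResiduallyFinite L) a ha
    refine ⟨K.map s, hfin K, ?_⟩
    rintro ⟨b, hb, hba⟩
    have hab : b = a := Subtype.ext (by rw [← hs, ← hs, hba])
    exact haK (hab ▸ hb)
  · refine ⟨s.range, ?_, hgs⟩
    rw [MonoidHom.range_eq_map]
    exact hfin ⊤

end GroupExtension

namespace FiniteClassifyingSpace

variable {Γ : Type u} [Group Γ] {V : Type v} [MulAction Γ V]

/-- Lifts to a central extension of the vertices and edges of a classifying space. -/
structure ExtensionLift {G : Type x} [Group G] {A : Type w} [AddCommGroup A]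
    (E : FiniteClassifyingSpace Γ V) (S : GroupExtension (Multiplicative A) G Γ) where
  h : V → Γ
  h_smul : ∀ (g : Γ) v, h (g • v) = g * h v
  l : V → G
  rightHom_l : ∀ v, S.rightHom (l v) = h v
  t : V → V → G
  rightHom_t : ∀ v w, S.rightHom (t v w) = (h v)⁻¹ * h w
  t_smul : ∀ (g : Γ) v w, t (g • v) (g • w) = t v w
  t_symm : ∀ v w, E.IsEdge v w → t w v = (t v w)⁻¹
  c : V → V → A
  inl_c : ∀ v w, S.inl (Multiplicative.ofAdd (c v w)) = l v * t v w * (l w)⁻¹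

variable {G : Type x} [Group G] {A : Type w} [AddCommGroup A]
    {E : FiniteClassifyingSpace Γ V} {S : GroupExtension (Multiplicative A) G Γ}

-- The lifts `t` can be chosen invariant because `(h v)⁻¹ * h w` is. The lifts `l` cannot in general
-- be equivariant, so `c` need not be invariant; only its sum around a triangle is.
variable (E S) in
theorem nonempty_extensionLift : Nonempty (E.ExtensionLift S) := by
  classical
  obtain ⟨h, hh⟩ := E.exists_equivariant
  obtain ⟨o, ho_smul, ho_symm⟩ := E.exists_orientation
  obtain ⟨s, hs⟩ := S.rightHom_surjective.hasRightInverse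
  -- The section `s` need not commute with inversion, so an invariant orientation decides which of
  -- the two orderings of an edge is lifted.
  let t (v w : V) : G := if o v w then s ((h v)⁻¹ * h w) else (s ((h w)⁻¹ * h v))⁻¹
  have ht (v w : V) : S.rightHom (t v w) = (h v)⁻¹ * h w := by
    simp only [t]
    split_ifs
    · exact hs _
    · rw [map_inv, hs]
      group
  have hc (v w : V) : ∃ a : A, S.inl (Multiplicative.ofAdd a) = s (h v) * t v w * (s (h w))⁻¹ := by
    have : s (h v) * t v w * (s (h w))⁻¹ ∈ S.inl.range := by
      rw [S.range_inl_eq_ker_rightHom, MonoidHom.mem_ker, map_mul, map_mul, map_inv, ht, hs, hs]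
      group
    exact this
  choose c hc using hc
  refine ⟨⟨h, hh, fun v => s (h v), fun v => hs _, t, ht, fun g v w => ?_,
    fun v w hvw => ?_, c, hc⟩⟩
  · simp only [t, ho_smul, hh, mul_inv_rev, mul_assoc, inv_mul_cancel_left]
  · simp only [t, ho_symm v w hvw]
    by_cases h1 : o v w
    · rw [if_neg (not_not.2 h1), if_pos h1]
    · rw [if_pos h1, if_neg h1, inv_inv]

namespace ExtensionLift

variable (T : E.ExtensionLift S)

theorem c_symm (v w : V) (hvw : E.IsEdge v w) : T.c w v = - T.c v w := by
  refine Multiplicative.ofAdd.injective (S.inl_injective ?_)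
  rw [ofAdd_neg, map_inv, T.inl_c, T.inl_c, T.t_symm v w hvw]
  group

/-- The factors `l` cancel around the triangle, up to a conjugation by `l u` that is harmless
because the result is central. What remains involves only the invariant lifts `t`, so the sum of `c`
is `Γ`-invariant. -/
theorem inl_sum (hS : S.inl.range ≤ Subgroup.center G) (u v w : V) :
    S.inl (Multiplicative.ofAdd (T.c u v + T.c v w + T.c w u)) =
    T.t u v * T.t v w * T.t w u := by
  have h1 := Subgroup.mem_center_iff.1
    (hS ⟨Multiplicative.ofAdd (T.c u v + T.c v w + T.c w u), rfl⟩) (T.l u)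
  refine mul_left_cancel (a := T.l u) ?_
  rw [h1, ofAdd_add, ofAdd_add, map_mul, map_mul, T.inl_c, T.inl_c, T.inl_c]
  group

theorem sum_smul (hS : S.inl.range ≤ Subgroup.center G) (g : Γ) (u v w : V) :
    T.c (g • u) (g • v) + T.c (g • v) (g • w) + T.c (g • w) (g • u) =
      T.c u v + T.c v w + T.c w u := by
  refine Multiplicative.ofAdd.injective (S.inl_injective ?_)
  rw [T.inl_sum hS, T.inl_sum hS, T.t_smul, T.t_smul, T.t_smul]

/-- A finite-index subgroup over which the cocycle of the extension has an invariant primitive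
splits the extension. -/
theorem exists_splitting (hS : S.inl.range ≤ Subgroup.center G) (L : Subgroup Γ) (b : V → V → A)
    (b_symm : ∀ v w, b w v = - b v w) (b_smul : ∀ g ∈ L, ∀ v w, b (g • v) (g • w) = b v w)
    (hb : ∀ x : E.OrdSimplex 2, b (x.vertex 0) (x.vertex 1) + b (x.vertex 1) (x.vertex 2) +
      b (x.vertex 2) (x.vertex 0) = T.c (x.vertex 0) (x.vertex 1) +
      T.c (x.vertex 1) (x.vertex 2) + T.c (x.vertex 2) (x.vertex 0)) :
    ∃ s : L →* G, ∀ g, S.rightHom (s g) = g := by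
  classical
  have := E.contractible
  -- The lifts of the edges are corrected by the primitive `b`. The default value `1` matters on the
  -- diagonal, where it gives the cocycle identity for degenerate triples.
  let t (v w : V) : G :=
    if E.IsEdge v w then T.t v w * S.inl (Multiplicative.ofAdd (- b v w)) else 1
  have t_self (v : V) : t v v = 1 := if_neg fun h => h.1 rfl
  have t_edge {v w : V} (h : E.IsEdge v w) :
      t v w = T.t v w * S.inl (Multiplicative.ofAdd (- b v w)) := if_pos h
  have hcomm (a : A) (g : G) : S.inl (Multiplicative.ofAdd a) * g =
      g * S.inl (Multiplicative.ofAdd a) := (Subgroup.mem_center_iff.1 (hS ⟨_, rfl⟩) g).symm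
  have t_symm {v w : V} (h : E.IsEdge v w) : t w v = (t v w)⁻¹ := by
    rw [t_edge h, t_edge h.symm, T.t_symm v w h, b_symm, neg_neg, mul_inv_rev, ← map_inv, ofAdd_neg,
      inv_inv, hcomm]
  have t_smul (g : Γ) (hg : g ∈ L) (v w : V) : t (g • v) (g • w) = t v w := by
    by_cases h : E.IsEdge v w
    · rw [t_edge h, t_edge (h.smul g), T.t_smul, b_smul g hg]
    · exact (if_neg fun h' => h (by simpa using h'.smul g⁻¹)).trans (if_neg h).symm
  have rightHom_t {s : Finset V} (hs : s ∈ E.complex.faces) {v w : V} (hv : v ∈ s) (hw : w ∈ s) :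
      S.rightHom (t v w) = (T.h v)⁻¹ * T.h w := by
    by_cases hvw : v = w
    · subst hvw
      rw [t_self, map_one, inv_mul_cancel]
    · rw [t_edge ⟨hvw, s, hs, hv, hw⟩, map_mul, S.rightHom_inl, mul_one, T.rightHom_t]
  have ht : ∀ s ∈ E.complex.faces, ∀ u ∈ s, ∀ v ∈ s, ∀ w ∈ s, t u v * t v w = t u w := by
    intro s hs u hu v hv w hw
    by_cases huv : u = v
    · subst huv
      rw [t_self, one_mul]
    by_cases hvw : v = w
    · subst hvw
      rw [t_self, mul_one]
    have Euv : E.IsEdge u v := ⟨huv, s, hs, hu, hv⟩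
    have Evw : E.IsEdge v w := ⟨hvw, s, hs, hv, hw⟩
    by_cases huw : u = w
    · subst huw
      rw [t_symm Euv, mul_inv_cancel, t_self]
    have Ewu : E.IsEdge w u := ⟨Ne.symm huw, s, hs, hw, hu⟩
    have hinj : Function.Injective ![u, v, w] := by
      intro i j hij
      fin_cases i <;> fin_cases j <;>
        first
        | rfl
        | exact absurd hij huv
        | exact absurd hij hvw
        | exact absurd hij huw
        | exact absurd hij (Ne.symm huv)
        | exact absurd hij (Ne.symm hvw)
        | exact absurd hij (Ne.symm huw)
    let x : E.OrdSimplex 2 := ⟨![u, v, w], hinj, by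
      refine (E.complex.isRelLowerSet_faces hs).2 (fun y hy => ?_)
        ⟨u, Finset.mem_map.2 ⟨0, Finset.mem_univ _, rfl⟩⟩
      obtain ⟨k, -, rfl⟩ := Finset.mem_map.1 hy
      fin_cases k
      exacts [hu, hv, hw]⟩
    have hx : b u v + b v w + b w u = T.c u v + T.c v w + T.c w u := hb x
    -- The correction contributes minus the sum of `b`, which by `hb` cancels the sum of `c`
    -- computed by `inl_sum`.
    have h1 : t u v * t v w * t w u = 1 := by
      have h2 : t u v * t v w * t w u = T.t u v * T.t v w * T.t w u *
          S.inl (Multiplicative.ofAdd (- (b u v + b v w + b w u))) := by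
        have h3 : - (b u v + b v w + b w u) = - b w u + (- b v w + - b u v) := by abel
        rw [t_edge Euv, t_edge Evw, t_edge Ewu, h3, ofAdd_add, ofAdd_add, map_mul, map_mul]
        simp only [mul_assoc]
        rw [hcomm (- b u v) (T.t v w * _), hcomm (- b v w) (T.t w u * _)]
        simp only [mul_assoc]
      rw [h2, hx, ← T.inl_sum hS, ← map_mul, ← ofAdd_add, add_neg_cancel, ofAdd_zero, map_one]
    rw [t_symm Ewu]
    exact eq_inv_of_mul_eq_one_left h1
  obtain ⟨θ, hθ⟩ := Realization.exists_potential t ht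
  obtain ⟨x⟩ := (inferInstance : Nonempty (Realization E.complex))
  obtain ⟨v₀, -⟩ := Realization.exists_mem_openStar x
  -- For `g ∈ L` both `θ` and its translate are potentials of the `L`-invariant cocycle `t`, so they
  -- differ by a left factor that is constant by connectedness. This factor depends multiplicatively
  -- on `g`.
  have hconst (g : Γ) (hg : g ∈ L) (v w : V) : θ (g • v) * (θ v)⁻¹ = θ (g • w) * (θ w)⁻¹ := by
    refine Realization.eq_of_eq_on_faces (K := E.complex) (fun v => θ (g • v) * (θ v)⁻¹)
      (fun s hs v hv w hw => ?_) v w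
    have hgv : g • v ∈ translateFinset g s := Finset.mem_map.2 ⟨v, hv, rfl⟩
    have hgw : g • w ∈ translateFinset g s := Finset.mem_map.2 ⟨w, hw, rfl⟩
    rw [← hθ s hs v hv w hw, ← hθ _ (E.translate_mem g s hs) _ hgv _ hgw, t_smul g hg]
    group
  -- Likewise the projection of `θ` and `h` are potentials of the same cocycle in `Γ`.
  have hκ (v : V) : S.rightHom (θ v) = S.rightHom (θ v₀) * (T.h v₀)⁻¹ * T.h v := by
    rw [← mul_inv_eq_iff_eq_mul]
    refine Realization.eq_of_eq_on_faces (K := E.complex) (fun v => S.rightHom (θ v) * (T.h v)⁻¹)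
      (fun s hs v hv w hw => ?_) v v₀
    rw [← hθ s hs v hv w hw, map_mul, rightHom_t hs hv hw]
    group
  -- The homomorphism obtained from `θ` projects to conjugation by this constant; conjugating by a
  -- lift `k` makes it a genuine section.
  obtain ⟨k, hk⟩ := S.rightHom_surjective (S.rightHom (θ v₀) * (T.h v₀)⁻¹)
  refine ⟨MonoidHom.mk' (fun g => k⁻¹ * (θ (g.1 • v₀) * (θ v₀)⁻¹) * k) fun g g' => ?_, fun g => ?_⟩
  · have h1 := hconst g.1 g.2 (g'.1 • v₀) v₀
    rw [← h1]
    simp only [Subgroup.coe_mul, mul_smul]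
    group
  · change S.rightHom (k⁻¹ * (θ (g.1 • v₀) * (θ v₀)⁻¹) * k) = g.1
    rw [map_mul, map_mul, map_mul, map_inv, map_inv, hκ (g.1 • v₀), hk, T.h_smul]
    group

variable [DistribMulAction Γ A]

theorem sum_smul' (hS : S.inl.range ≤ Subgroup.center G) (hA : ∀ (g : Γ) (a : A), g • a = a)
    (g : Γ) (x : E.OrdSimplex 2) :
    T.c (g • x.vertex 0) (g • x.vertex 1) + T.c (g • x.vertex 1) (g • x.vertex 2) +
      T.c (g • x.vertex 2) (g • x.vertex 0) = g • (T.c (x.vertex 0) (x.vertex 1) +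
        T.c (x.vertex 1) (x.vertex 2) + T.c (x.vertex 2) (x.vertex 0)) := by
  rw [hA, T.sum_smul hS]

variable (hS : S.inl.range ≤ Subgroup.center G) (hA : ∀ (g : Γ) (a : A), g • a = a)

/-- The 2-cocycle of a central extension. -/
def cocycle : E.cochains A 2 := E.boundaryCochain T.c T.c_symm (T.sum_smul' hS hA)

theorem cocycle_mem : T.cocycle hS hA ∈ E.cocycles A 2 := boundaryCochain_mem_cocycles _ _

theorem cocycle_apply (x : E.OrdSimplex 2) : (T.cocycle hS hA).1 x = T.c (x.vertex 0) (x.vertex 1) +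
    T.c (x.vertex 1) (x.vertex 2) + T.c (x.vertex 2) (x.vertex 0) := rfl

end ExtensionLift

end FiniteClassifyingSpace

end Extension

/-! ### Evaluation at a point of a finite action -/

section Evaluation

namespace StepFun

variable {X : Type v} {A : Type w} [Fintype A]

theorem exists_mem_part (f : StepFun (Set X) A) (o : X) : ∃ a, o ∈ f.part a := by
  have h : o ∈ Finset.univ.sup f.part := f.sup_eq_top ▸ Set.mem_univ o
  rw [Finset.sup_set_eq_biUnion] at h
  simpa using h

/-- The value at a point of a step function on a power set. -/
noncomputable def eval (o : X) (f : StepFun (Set X) A) : A := (f.exists_mem_part o).choose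

theorem mem_part_eval (o : X) (f : StepFun (Set X) A) : o ∈ f.part (eval o f) :=
  (f.exists_mem_part o).choose_spec

theorem eval_eq {o : X} {f : StepFun (Set X) A} {a : A} (h : o ∈ f.part a) : eval o f = a := by
  by_contra hne
  exact Set.disjoint_left.1 (f.disjoint _ _ hne) (mem_part_eval o f) h

variable [AddCommGroup A]

theorem eval_add (o : X) (f g : StepFun (Set X) A) : eval o (f + g) = eval o f + eval o g :=
  eval_eq (inf_le_add f g rfl ⟨mem_part_eval o f, mem_part_eval o g⟩)

theorem eval_neg (o : X) (f : StepFun (Set X) A) : eval o (-f) = - eval o f := by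
  refine eval_eq ?_
  change o ∈ f.part (- - eval o f)
  rw [neg_neg]
  exact mem_part_eval o f

theorem eval_const (o : X) (a : A) : eval o (const a : StepFun (Set X) A) = a := by
  refine eval_eq ?_
  rw [const_part, if_pos rfl]
  trivial

end StepFun

/-- This makes evaluation at `o` a homomorphism of modules over the stabilizer of `o`, with trivial
action on `A`. -/
theorem MeasuredBoolAlg.eval_smul {Γ : Type u} [Group Γ] {X : Type v} [Finite X] [Nonempty X]
    {σ : Γ →* Equiv.Perm X} {A : Type w} [Fintype A] [AddCommGroup A] {o : X} {g : Γ}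
    (hg : σ g o = o) (f : (powerSet X σ).Coeff A) :
    StepFun.eval o (g • f : (powerSet X σ).Coeff A) = StepFun.eval o f :=
  StepFun.eval_eq (X := X) ⟨o, StepFun.mem_part_eval o f, hg⟩

namespace FiniteClassifyingSpace.ExtensionLift

open MeasuredBoolAlg

variable {Γ : Type u} [Group Γ] {V : Type v} [MulAction Γ V] {G : Type x} [Group G] {A : Type w}
  [AddCommGroup A] {E : FiniteClassifyingSpace Γ V} {S : GroupExtension (Multiplicative A) G Γ}

/-- A central extension by a finite group whose cocycle becomes trivial in a finite action is
residually finite. -/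
theorem residuallyFinite_of_differential_eq [Fintype A] [DistribMulAction Γ A]
    (T : E.ExtensionLift S) (hS : S.inl.range ≤ Subgroup.center G)
    (hA : ∀ (g : Γ) (a : A), g • a = a) (hΓ : Group.ResiduallyFinite Γ)
    {P : MeasuredBoolAlg.{u, 0} Γ} (hP : P ∈ finiteTransitiveActions Γ)
    {b : E.cochains (P.Coeff A) 1}
    (hb : E.differential (P.Coeff A) 1 b = E.mapCochains (constCoeff P hA) 2 (T.cocycle hS hA)) :
    Group.ResiduallyFinite G := by
  obtain ⟨X, _, _, σ, -, rfl⟩ := hP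
  obtain ⟨o⟩ := (inferInstance : Nonempty X)
  let L : Subgroup Γ := (MulAction.stabilizer (Equiv.Perm X) o).comap σ
  have hker : σ.ker.FiniteIndex := Subgroup.finiteIndex_ker σ
  have hL : L.FiniteIndex := Subgroup.finiteIndex_of_le (H := σ.ker) fun g hg => by
    change σ g o = o
    rw [MonoidHom.mem_ker.1 hg, Equiv.Perm.one_apply]
  -- Evaluation at `o` turns the `Γ`-equivariant primitive with values in `P(A)` into an
  -- `L`-invariant one with values in `A`, and fixes the constants coming from `β`.
  obtain ⟨s, hs⟩ := T.exists_splitting hS L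
    (fun v w => StepFun.eval o (edgeValue b v w : (powerSet X σ).Coeff A))
    (fun v w => by
      rw [edgeValue_symm]
      exact StepFun.eval_neg o _)
    (fun g hg v w => by
      rw [edgeValue_smul]
      exact eval_smul (hg : σ g o = o) _)
    (fun x => by
      have h1 := congrArg (fun c => StepFun.eval o (c.1 x)) hb
      rw [differential_apply_two] at h1
      refine Eq.trans ?_ (h1.trans (StepFun.eval_const o _))
      refine Eq.trans ?_ (StepFun.eval_add o _ _).symm
      exact congrArg (· + _) (StepFun.eval_add o _ _).symm)
  exact S.residuallyFinite_of_splits hΓ L s hs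

end FiniteClassifyingSpace.ExtensionLift

end Evaluation

/-! ### Measurable equivariant maps for actions of a finite group -/

section FreeActions

open MeasureTheory

variable {X : Type v} [MeasurableSpace X] {A : Type w} [AddCommGroup A]

/-- The free part of an action. -/
def freePart (α : Multiplicative A →* Equiv.Perm X) : Set X := {x | ∀ a, a ≠ 1 → α a x ≠ x}

variable [StandardBorelSpace X] {α : Multiplicative A →* Equiv.Perm X}

/-- An embedding into `ℝ` turns the fixed-point equation into equality of two measurable real
functions. -/
theorem measurableSet_fixed {f : X → X} (hf : Measurable f) : MeasurableSet {x | f x = x} := by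
  have h : {x | f x = x} = {x | embeddingReal X (f x) = embeddingReal X x} := by
    ext x
    exact (measurableEmbedding_embeddingReal X).injective.eq_iff.symm
  rw [h]
  exact measurableSet_eq_fun ((measurable_embeddingReal X).comp hf) (measurable_embeddingReal X)

theorem measurableSet_freePart [Finite A] (hα : ∀ a, Measurable (α a)) :
    MeasurableSet (freePart α) := by
  have h : freePart α = ⋂ (a : Multiplicative A) (_ : a ≠ 1), {x | α a x = x}ᶜ := by
    ext x
    simp [freePart]
  rw [h]
  exact MeasurableSet.iInter fun a => MeasurableSet.iInter fun _ =>
    (measurableSet_fixed (hα a)).compl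

/-- A measurable action of a finite group admits a measurable map to the group which is equivariant
on the free part. -/
theorem exists_measurable_equivariant [Finite A] (hα : ∀ a, Measurable (α a)) : ∃ φ : X → A,
    (∀ c, MeasurableSet {x | φ x = c}) ∧
      ∀ x ∈ freePart α, ∀ a, φ (α a x) = a.toAdd + φ x := by
  classical
  let e := embeddingReal X
  have he : Function.Injective e := (measurableEmbedding_embeddingReal X).injective
  have he' : Measurable e := measurable_embeddingReal X
  -- The points that are minimal in their orbit for the order pulled back from `ℝ`. Every orbit is
  -- finite and therefore meets `D`, and on the free part only one group element moves a given point
  -- into `D`.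
  let D : Set X := {x | ∀ a, e x ≤ e (α a x)}
  have hD : MeasurableSet D := by
    have h : D = ⋂ a, {x | e x ≤ e (α a x)} := by
      ext x
      simp [D]
    rw [h]
    exact MeasurableSet.iInter fun a => measurableSet_le he' (he'.comp (hα a))
  have hex (x : X) : ∃ a, α a x ∈ D := by
    obtain ⟨a, ha⟩ := Finite.exists_min fun a : Multiplicative A => e (α a x)
    refine ⟨a, fun b => ?_⟩
    rw [← Equiv.Perm.mul_apply, ← map_mul]
    exact ha _
  have huniq {x : X} (hx : x ∈ freePart α) {a b : Multiplicative A} (ha : α a x ∈ D)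
      (hb : α b x ∈ D) : a = b := by
    have h1 : e (α a x) ≤ e (α b x) := by
      have := ha (b * a⁻¹)
      rwa [← Equiv.Perm.mul_apply, ← map_mul, inv_mul_cancel_right] at this
    have h2 : e (α b x) ≤ e (α a x) := by
      have := hb (a * b⁻¹)
      rwa [← Equiv.Perm.mul_apply, ← map_mul, inv_mul_cancel_right] at this
    have h3 : α (b⁻¹ * a) x = x := by
      rw [map_mul, Equiv.Perm.mul_apply, he (le_antisymm h1 h2), ← Equiv.Perm.mul_apply, ← map_mul,
        inv_mul_cancel, map_one, Equiv.Perm.one_apply]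
    by_contra hne
    exact hx _ (fun h => hne (inv_mul_eq_one.1 h).symm) h3
  choose p hp using hex
  have hpa {x : X} (hx : x ∈ freePart α) (a : Multiplicative A) : p x = a ↔ α a x ∈ D :=
    ⟨fun h => h ▸ hp x, fun h => huniq hx (hp x) h⟩
  -- The sign is needed because `p (α a x) = p x * a⁻¹`. Off the free part `p` is an arbitrary
  -- choice, so the value `0` is used there to keep the map measurable.
  refine ⟨fun x => if x ∈ freePart α then - (p x).toAdd else 0, fun c => ?_, fun x hx a => ?_⟩
  · have h : {x | (if x ∈ freePart α then - (p x).toAdd else 0) = c} =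
        (freePart α ∩ α (Multiplicative.ofAdd (-c)) ⁻¹' D) ∪ ((freePart α)ᶜ ∩ {_x | 0 = c}) := by
      ext x
      by_cases hx : x ∈ freePart α
      · simp only [Set.mem_ofPred_eq, if_true, Set.mem_union, Set.mem_inter_iff, hx, true_and,
          Set.mem_compl_iff, not_true_eq_false, false_and, or_false, Set.mem_preimage, ← hpa hx]
        rw [neg_eq_iff_eq_neg]
        exact Iff.rfl
      · simp [hx]
    rw [h]
    exact ((measurableSet_freePart hα).inter (hα _ hD)).union
      ((measurableSet_freePart hα).compl.inter (MeasurableSet.const _))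
  · have hax : α a x ∈ freePart α := by
      intro b hb h
      refine hx b hb ((α a).injective ?_)
      rw [← Equiv.Perm.mul_apply, ← map_mul, mul_comm a b, map_mul, Equiv.Perm.mul_apply, h]
    have hpx : p (α a x) = p x * a⁻¹ := by
      rw [hpa hax, ← Equiv.Perm.mul_apply, ← map_mul, inv_mul_cancel_right]
      exact hp x
    change (if α a x ∈ freePart α then - (p (α a x)).toAdd else 0) =
      a.toAdd + if x ∈ freePart α then - (p x).toAdd else 0
    rw [if_pos hax, if_pos hx, hpx, toAdd_mul, toAdd_inv]
    abel

end FreeActions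

/-! ### Essential freeness of the kernel on the Bernoulli shift -/

section BernoulliFree

open MeasureTheory

open Classical in
/-- Flipping one coordinate. -/
noncomputable def flipCoord {G : Type v} (k : G) (x : G → Bool) : G → Bool :=
  fun h => if h = k then !x h else x h

/-- The flip acts coordinate by coordinate, and the uniform measure on `Bool` is invariant under
negation. -/
theorem measurePreserving_flipCoord {G : Type v} (k : G) :
    MeasurePreserving (flipCoord k) (bernoulliMeasure G) (bernoulliMeasure G) := by
  classical
  let f (h : G) : Bool → Bool := if h = k then (fun b => !b) else id
  have hf : flipCoord k = fun x h => f h (x h) := by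
    funext x h
    simp only [flipCoord, f]
    split_ifs <;> rfl
  have hfm (h : G) : Measurable (f h) := measurable_of_countable _
  refine ⟨hf ▸ measurable_pi_lambda _ fun h => (hfm h).comp (measurable_pi_apply h), ?_⟩
  unfold bernoulliMeasure
  rw [hf, Measure.infinitePi_map_pi _ hfm]
  congr 1
  funext h
  refine Measure.ext_of_singleton fun b => ?_
  rw [Measure.map_apply (hfm h) (measurableSet_singleton b)]
  simp only [f]
  split_ifs
  · have : (fun b => !b) ⁻¹' {b} = {!b} := by
      ext c
      cases b <;> cases c <;> simp
    rw [this, PMF.toMeasure_apply_singleton _ _ (measurableSet_singleton _),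
      PMF.toMeasure_apply_singleton _ _ (measurableSet_singleton _),
      PMF.uniformOfFintype_apply, PMF.uniformOfFintype_apply]
  · rfl

variable {A : Type w} [AddCommGroup A] {G : Type v} [Group G] [Countable G] {Γ : Type u} [Group Γ]
  (S : GroupExtension (Multiplicative A) G Γ)

/-- A fixed point satisfies `x(k) = x(ak)` for all `k`. Flipping one representative `l γ` in each
coset of the kernel breaks this relation in that coset only, so the flipped copies of the fixed set
are pairwise disjoint. They all have the same measure, and there are infinitely many of them in a
probability space. -/
theorem bernoulliMeasure_fixed [Infinite Γ] {a : Multiplicative A} (ha : a ≠ 1) :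
    bernoulliMeasure G {x | bernoulliShift G (S.inl a) x = x} = 0 := by
  obtain ⟨l, hl⟩ := S.rightHom_surjective.hasRightInverse
  set N := {x | bernoulliShift G (S.inl a) x = x} with hN
  have hNm : MeasurableSet N :=
    measurableSet_fixed (measurePreserving_bernoulliShift G (S.inl a)).measurable
  have hmem {γ : Γ} {x : G → Bool} (hx : flipCoord (l γ) x ∈ N) :
      (!x (l γ)) = x (S.inl a * l γ) ∧
        ∀ γ', γ' ≠ γ → flipCoord (l γ') x ∈ N → x (l γ) = x (S.inl a * l γ) := by
    have hne : S.inl a * l γ ≠ l γ := fun h =>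
      ha (S.inl_injective ((mul_eq_right.1 h).trans (map_one _).symm))
    have key {y : G → Bool} (hy : y ∈ N) : y (l γ) = y (S.inl a * l γ) := by
      have := congrFun hy (S.inl a * l γ)
      change y ((S.inl a)⁻¹ * (S.inl a * l γ)) = _ at this
      rwa [inv_mul_cancel_left] at this
    constructor
    · have := key hx
      simpa [flipCoord, hne] using this
    · intro γ' hγ hx'
      have h1 : l γ ≠ l γ' := fun h => hγ (by rw [← hl γ, ← hl γ', h])
      have h2 : S.inl a * l γ ≠ l γ' := fun h => hγ (by
        rw [← hl γ, ← hl γ', ← h, map_mul, S.rightHom_inl, one_mul])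
      have := key hx'
      simpa [flipCoord, h1, h2] using this
  by_contra hpos
  have hfin := Measure.finite_const_le_meas_of_disjoint_iUnion (bernoulliMeasure G)
    (pos_iff_ne_zero.2 hpos) (As := fun γ : Γ => flipCoord (l γ) ⁻¹' N)
    (fun γ => (measurePreserving_flipCoord (l γ)).measurable hNm)
    (fun γ γ' hγ => Set.disjoint_left.2 fun x hx hx' => by
      obtain ⟨h1, h2⟩ := hmem hx
      rw [← h2 γ' hγ.symm hx'] at h1
      cases h : x (l γ) <;> simp [h] at h1)
    (measure_ne_top _ _)
  have huniv : {γ : Γ | bernoulliMeasure G N ≤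
      bernoulliMeasure G (flipCoord (l γ) ⁻¹' N)} = Set.univ :=
    Set.eq_univ_of_forall fun γ =>
      ((measurePreserving_flipCoord (l γ)).measure_preimage hNm.nullMeasurableSet).ge
  rw [huniv] at hfin
  exact Set.infinite_univ hfin

theorem bernoulliMeasure_compl_freePart [Finite A] [Infinite Γ] :
    bernoulliMeasure G (freePart ((bernoulliShift G).comp S.inl))ᶜ = 0 := by
  have h : (freePart ((bernoulliShift G).comp S.inl))ᶜ =
      ⋃ (a : Multiplicative A) (_ : a ≠ 1), {x | bernoulliShift G (S.inl a) x = x} := by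
    ext x
    simp [freePart]
  have : Countable (Multiplicative A) := inferInstanceAs (Countable A)
  rw [h, measure_iUnion_null_iff]
  intro a
  rw [measure_iUnion_null_iff]
  exact fun ha => bernoulliMeasure_fixed S ha

end BernoulliFree

/-! ### Exactness of the extension cocycle over the Bernoulli quotient -/

section BernoulliCochain

open MeasureTheory

namespace StepFun

variable {Y : Type v} [MeasurableSpace Y] {A : Type w} [Fintype A]

/-- The step function of a measurable function to a finite set. -/
def ofFun (f : Y → A) (hf : ∀ a, MeasurableSet {y | f y = a}) :
    StepFun {B : Set Y // MeasurableSet B} A where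
  part a := ⟨{y | f y = a}, hf a⟩
  disjoint a b h := by
    refine disjoint_iff_inf_le.2 fun y hy => h ?_
    exact (hy.1 : f y = a).symm.trans hy.2
  sup_eq_top := by
    refine top_le_iff.1 fun y _ => ?_
    have h : (⟨{y | f y = f y}, by simp⟩ : {B : Set Y // MeasurableSet B}) ≤ ⊤ := le_top
    exact Finset.le_sup (f := fun a => (⟨{y | f y = a}, hf a⟩ : {B : Set Y // MeasurableSet B}))
      (Finset.mem_univ (f y)) (rfl : f y = f y)

theorem ofFun_eq {f : Y → A} (hf : ∀ a, MeasurableSet {y | f y = a})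
    {F : StepFun {B : Set Y // MeasurableSet B} A} (h : ∀ y, y ∈ (F.part (f y)).1) :
    ofFun f hf = F :=
  ext_of_le fun a y (hy : f y = a) => hy ▸ h y

theorem eq_of_mem_part {F : StepFun {B : Set Y // MeasurableSet B} A} {y : Y} {a b : A}
    (ha : y ∈ (F.part a).1) (hb : y ∈ (F.part b).1) : a = b := by
  by_contra h
  exact disjoint_iff_inf_le.1 (F.disjoint a b h) ⟨ha, hb⟩

variable [AddCommGroup A]

theorem mem_part_add {F F' : StepFun {B : Set Y // MeasurableSet B} A} {y : Y} {a b : A}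
    (ha : y ∈ (F.part a).1) (hb : y ∈ (F'.part b).1) : y ∈ ((F + F').part (a + b)).1 :=
  inf_le_add F F' rfl ⟨ha, hb⟩

theorem mem_part_neg {F : StepFun {B : Set Y // MeasurableSet B} A} {y : Y} {a : A}
    (ha : y ∈ (F.part a).1) : y ∈ ((-F).part (-a)).1 := by
  change y ∈ (F.part (- -a)).1
  rwa [neg_neg]

theorem mem_part_const (y : Y) (a : A) :
    y ∈ ((const a : StepFun {B : Set Y // MeasurableSet B} A).part a).1 := by
  rw [const_part, if_pos rfl]
  trivial

end StepFun

namespace FiniteClassifyingSpace.ExtensionLift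

open MeasuredBoolAlg

variable {Γ : Type u} [Group Γ] {V : Type v} [MulAction Γ V] {G : Type x} [Group G]
  {A : Type w} [AddCommGroup A] {E : FiniteClassifyingSpace Γ V}
  {S : GroupExtension (Multiplicative A) G Γ} (T : E.ExtensionLift S)

open Classical in
/-- The primitive of the cocycle of the extension on the free part of the Bernoulli shift. -/
noncomputable def bernoulliPrimitive (φ : (G → Bool) → A) (v w : V) (x : G → Bool) : A :=
  if x ∈ freePart ((bernoulliShift G).comp S.inl) then
    φ (bernoulliShift G (T.l v)⁻¹ x) - φ (bernoulliShift G (T.l w)⁻¹ x) + T.c v w else 0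

theorem freePart_shift (hS : S.inl.range ≤ Subgroup.center G) (g : G) (x : G → Bool) :
    bernoulliShift G g x ∈ freePart ((bernoulliShift G).comp S.inl) ↔
      x ∈ freePart ((bernoulliShift G).comp S.inl) := by
  refine forall₂_congr fun a _ => not_congr ?_
  rw [MonoidHom.comp_apply, ← Equiv.Perm.mul_apply, ← map_mul,
    ← Subgroup.mem_center_iff.1 (hS ⟨a, rfl⟩) g, map_mul, Equiv.Perm.mul_apply,
    EmbeddingLike.apply_eq_iff_eq]

/-- The lifts satisfy `l(gv) = g l(v) z_v` with `z_v` in the kernel. The failure of equivariance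
changes the difference of the values of `φ` by `z_w - z_v` and `c` by `z_v - z_w`, and these cancel.
-/
theorem bernoulliPrimitive_smul {φ : (G → Bool) → A}
    (hφ : ∀ x ∈ freePart ((bernoulliShift G).comp S.inl),
      ∀ a, φ (((bernoulliShift G).comp S.inl) a x) = a.toAdd + φ x)
    (hS : S.inl.range ≤ Subgroup.center G) (g : G) (v w : V)
    (x : G → Bool) : T.bernoulliPrimitive φ (S.rightHom g • v) (S.rightHom g • w)
      (bernoulliShift G g x) = T.bernoulliPrimitive φ v w x := by
  unfold bernoulliPrimitive
  by_cases hx : x ∈ freePart ((bernoulliShift G).comp S.inl)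
  swap
  · rw [if_neg hx, if_neg fun h => hx ((freePart_shift hS g x).1 h)]
  rw [if_pos hx, if_pos ((freePart_shift hS g x).2 hx)]
  have hz (v : V) : ∃ a : Multiplicative A, T.l (S.rightHom g • v) = g * T.l v * S.inl a := by
    have : (g * T.l v)⁻¹ * T.l (S.rightHom g • v) ∈ S.inl.range := by
      rw [S.range_inl_eq_ker_rightHom, MonoidHom.mem_ker, map_mul, map_inv, map_mul,
        T.rightHom_l, T.rightHom_l, T.h_smul, inv_mul_cancel]
    obtain ⟨a, ha⟩ := this
    exact ⟨a, by rw [ha, mul_inv_cancel_left]⟩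
  choose z hz using hz
  have hφz (v : V) : φ (bernoulliShift G (T.l (S.rightHom g • v))⁻¹ (bernoulliShift G g x)) =
      - (z v).toAdd + φ (bernoulliShift G (T.l v)⁻¹ x) := by
    rw [← toAdd_inv, ← hφ _ ((freePart_shift hS _ _).2 hx), ← Equiv.Perm.mul_apply, ← map_mul,
      MonoidHom.comp_apply, ← Equiv.Perm.mul_apply, ← map_mul, hz, map_inv]
    congr 3
    group
  have hc : T.c (S.rightHom g • v) (S.rightHom g • w) =
      T.c v w + ((z v).toAdd - (z w).toAdd) := by
    refine Multiplicative.ofAdd.injective (S.inl_injective ?_)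
    have hcomm (a : Multiplicative A) (k : G) : k * S.inl a = S.inl a * k :=
      Subgroup.mem_center_iff.1 (hS ⟨a, rfl⟩) k
    have h1 : T.l v * T.t v w = S.inl (Multiplicative.ofAdd (T.c v w)) * T.l w := by
      rw [T.inl_c, inv_mul_cancel_right]
    rw [ofAdd_add, map_mul, T.inl_c (_ • v), T.t_smul, hz, hz, ofAdd_sub, map_div, ofAdd_toAdd,
      ofAdd_toAdd, hcomm (z v), hcomm (z w), mul_assoc (S.inl (z v)), mul_assoc g, h1,
      ← mul_assoc g, hcomm _ g, ← hcomm _ (S.inl (z v) / S.inl (z w)), div_eq_mul_inv,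
      mul_assoc (S.inl (z v)) (S.inl (z w))⁻¹, hcomm _ (S.inl (z w))⁻¹]
    group
  rw [hφz, hφz, hc]
  abel

/-- The kernel acts trivially on the vertices, so its invariance is a case of equivariance. It lets
the primitive descend to the space of orbits. -/
theorem bernoulliPrimitive_inl {φ : (G → Bool) → A}
    (hφ : ∀ x ∈ freePart ((bernoulliShift G).comp S.inl),
      ∀ a, φ (((bernoulliShift G).comp S.inl) a x) = a.toAdd + φ x)
    (hS : S.inl.range ≤ Subgroup.center G) (a : Multiplicative A)
    (v w : V) (x : G → Bool) : T.bernoulliPrimitive φ v w (bernoulliShift G (S.inl a) x) =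
      T.bernoulliPrimitive φ v w x := by
  have h := T.bernoulliPrimitive_smul hφ hS (S.inl a) v w x
  rwa [S.rightHom_inl, one_smul, one_smul] at h

theorem bernoulliPrimitive_symm (φ : (G → Bool) → A) {v w : V} (hvw : E.IsEdge v w)
    (x : G → Bool) : T.bernoulliPrimitive φ w v x = - T.bernoulliPrimitive φ v w x := by
  unfold bernoulliPrimitive
  split_ifs
  · rw [T.c_symm v w hvw]
    abel
  · rw [neg_zero]

theorem bernoulliPrimitive_sum (φ : (G → Bool) → A) (u v w : V) {x : G → Bool}
    (hx : x ∈ freePart ((bernoulliShift G).comp S.inl)) : T.bernoulliPrimitive φ u v x +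
      T.bernoulliPrimitive φ v w x + T.bernoulliPrimitive φ w u x =
      T.c u v + T.c v w + T.c w u := by
  unfold bernoulliPrimitive
  rw [if_pos hx, if_pos hx, if_pos hx]
  abel

theorem measurableSet_bernoulliPrimitive [Countable G] [Finite A] {φ : (G → Bool) → A}
    (hφm : ∀ a, MeasurableSet {x | φ x = a}) (v w : V) (a : A) :
    MeasurableSet {x | T.bernoulliPrimitive φ v w x = a} := by
  let _ : MeasurableSpace A := ⊤
  have : DiscreteMeasurableSpace A := ⟨fun _ => trivial⟩
  have hφ' : Measurable φ := measurable_to_countable' hφm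
  have hfree := measurableSet_freePart (α := (bernoulliShift G).comp S.inl)
    fun a => (measurePreserving_bernoulliShift G (S.inl a)).measurable
  have hm : Measurable (T.bernoulliPrimitive φ v w) := by
    refine Measurable.ite hfree ?_ measurable_const
    exact ((hφ'.comp (measurePreserving_bernoulliShift G _).measurable).sub
      (hφ'.comp (measurePreserving_bernoulliShift G _).measurable)).add_const _
  exact hm (measurableSet_singleton a)

/-- The cocycle of a central extension becomes trivial in the quotient of the Bernoulli shift by
the kernel of the extension. -/
theorem isNearlyExact_bernoulli [Fintype A] [Countable G] [Infinite Γ] [DistribMulAction Γ A]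
    (hS : S.inl.range ≤ Subgroup.center G) (hA : ∀ (g : Γ) (a : A), g • a = a)
    (ν : E.Cell 2 → ℝ) {ε : ℝ} (hε : 0 < ε) :
    E.IsNearlyExact hA ν (T.cocycle hS hA) ε
      (measurableSets (bernoulliQuotientMeasure S) (bernoulliQuotientAction S)
        (measurePreserving_bernoulliQuotientAction S)) := by
  set P := measurableSets (bernoulliQuotientMeasure S) (bernoulliQuotientAction S)
        (measurePreserving_bernoulliQuotientAction S)
  have hαm (a : Multiplicative A) : Measurable (((bernoulliShift G).comp S.inl) a) :=
    (measurePreserving_bernoulliShift G (S.inl a)).measurable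
  obtain ⟨φ, hφm, hφ⟩ := exists_measurable_equivariant hαm
  let f (v w : V) : BernoulliQuotient S → A := Quotient.lift (T.bernoulliPrimitive φ v w) (by
    rintro x _ ⟨a, rfl⟩
    exact (T.bernoulliPrimitive_inl hφ hS a v w x).symm)
  -- A subset of the quotient is measurable exactly when its preimage is.
  have hf (v w : V) (a : A) : MeasurableSet {y | f v w y = a} :=
    T.measurableSet_bernoulliPrimitive hφm v w a
  let F (v w : V) : P.Coeff A := StepFun.ofFun (f v w) (hf v w)
  have F_symm (v w : V) (hvw : E.IsEdge v w) : F w v = - F v w := by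
    refine StepFun.ofFun_eq _ fun y => ?_
    have h1 : f w v y = - f v w y := by
      induction y using Quotient.inductionOn
      exact T.bernoulliPrimitive_symm φ hvw _
    rw [h1]
    exact StepFun.mem_part_neg (rfl : f v w y = f v w y)
  have F_smul (g : Γ) (v w : V) (_ : E.IsEdge v w) : F (g • v) (g • w) = g • F v w := by
    refine StepFun.ofFun_eq _ fun y => ?_
    obtain ⟨k, rfl⟩ := S.rightHom_surjective g
    obtain ⟨y, rfl⟩ := (bernoulliQuotientAction S (S.rightHom k)).surjective y
    refine ⟨y, ?_, rfl⟩
    induction y using Quotient.inductionOn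
    rename_i x
    rw [bernoulliQuotientAction_apply]
    exact (T.bernoulliPrimitive_smul hφ hS k v w x).symm
  let b : E.cochains (P.Coeff A) 1 := E.edgeCochain F F_symm F_smul
  refine ⟨b, ?_⟩
  have hb (x : E.OrdSimplex 2) {j k : Fin 3} (hjk : j ≠ k) :
      edgeValue b (x.vertex j) (x.vertex k) = F (x.vertex j) (x.vertex k) :=
    edgeValue_vertex b x hjk
  -- On the free part the terms in `φ` telescope and the defect takes the value `0`; its nonzero
  -- parts therefore lie over the complement, a null set.
  have hlen (x : E.OrdSimplex 2) : coeffLength ((E.defect hA P (T.cocycle hS hA) b).1 x) = 0 := by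
    classical
    refine Finset.sum_eq_zero fun a ha => ?_
    have ha0 : a ≠ 0 := (Finset.mem_filter.1 ha).2
    set D := (E.defect hA P (T.cocycle hS hA) b).1 x with hD
    have hD' : D = constCoeff P hA ((T.cocycle hS hA).1 x) + - (F (x.vertex 0) (x.vertex 1) +
        F (x.vertex 1) (x.vertex 2) + F (x.vertex 2) (x.vertex 0)) := by
      have h1 := differential_apply_two b x
      rw [hb x (by decide), hb x (by decide), hb x (by decide)] at h1
      rw [← h1, hD, ← sub_eq_add_neg]
      rfl
    change (bernoulliQuotientMeasure S).real (D.part a).1 = 0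
    rw [measureReal_eq_zero_iff]
    unfold bernoulliQuotientMeasure
    rw [Measure.map_apply measurable_quotient_mk'' (D.part a).2]
    refine measure_mono_null ?_ (bernoulliMeasure_compl_freePart S)
    intro y hy hfree
    refine ha0 ?_
    refine StepFun.eq_of_mem_part (hy : Quotient.mk (bernoulliOrbit S) y ∈ (D.part a).1) ?_
    have hmem (v w : V) : Quotient.mk (bernoulliOrbit S) y ∈
        ((F v w).part (T.bernoulliPrimitive φ v w y)).1 := rfl
    have h2 := StepFun.mem_part_add (StepFun.mem_part_const (Quotient.mk (bernoulliOrbit S) y)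
      ((T.cocycle hS hA).1 x)) (StepFun.mem_part_neg (StepFun.mem_part_add
        (StepFun.mem_part_add (hmem (x.vertex 0) (x.vertex 1)) (hmem (x.vertex 1) (x.vertex 2)))
        (hmem (x.vertex 2) (x.vertex 0))))
    rw [T.bernoulliPrimitive_sum φ _ _ _ hfree, ← T.cocycle_apply hS hA, add_neg_cancel] at h2
    rw [hD']
    exact h2
  have h0 : cochainLength ν (E.defect hA P (T.cocycle hS hA) b) = 0 :=
    Finset.sum_eq_zero fun c _ => by rw [hlen, zero_mul]
  rw [h0]
  exact hε

end FiniteClassifyingSpace.ExtensionLift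

end BernoulliCochain

/-! ### Proof of the theorem -/

namespace GroupExtension

variable {N G Γ : Type*} [Group N] [Group G] [Group Γ]

theorem exists_surjective (S : GroupExtension N G Γ) :
    ∃ f : N × Γ → G, Function.Surjective f := by
  obtain ⟨s, hs⟩ := S.rightHom_surjective.hasRightInverse
  refine ⟨fun p => S.inl p.1 * s p.2, fun g => ?_⟩
  have h : g * (s (S.rightHom g))⁻¹ ∈ S.inl.range := by
    rw [S.range_inl_eq_ker_rightHom, MonoidHom.mem_ker, map_mul, map_inv, hs, mul_inv_cancel]
  obtain ⟨n, hn⟩ := h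
  exact ⟨(n, S.rightHom g), by simp [hn]⟩

end GroupExtension

theorem mainTheorem7 {Γ Γ' A V : Type*} [Group Γ] [Countable Γ] [Group Γ']
    [AddCommGroup A] [Fintype A] [MulAction Γ V]
    (hΓ : Group.ResiduallyFinite Γ)
    (E : FiniteClassifyingSpace Γ V)
    (ν : E.Cell 2 → ℝ) (hν : FiniteClassifyingSpace.IsFaithfulProbability ν)
    (hcos : E.SatisfiesCosystolicInequality 2 ν (MeasuredBoolAlg.finiteTransitiveActions Γ) A)
    (S : GroupExtension (Multiplicative A) Γ' Γ)
    (hcentral : S.inl.range ≤ Subgroup.center Γ')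
    (hΓ' : ¬ Group.ResiduallyFinite Γ')
    (hstable : IsStableInFiniteActions Γ) :
    ¬ IsSoficAction (bernoulliQuotientMeasure S) (bernoulliQuotientAction S)
      (measurePreserving_bernoulliQuotientAction S) := by
  rintro ⟨m, π, hπ, s, U, hU, hw⟩
  have : Finite (Multiplicative A) := inferInstanceAs (Finite A)
  have : Countable Γ' := S.exists_surjective.choose_spec.countable
  -- If `Γ` were finite, so would be `Γ'`, which would then be residually finite.
  have : Infinite Γ := by
    by_contra h
    have : Finite Γ := not_infinite_iff_finite.1 h
    have : Finite Γ' := .of_surjective _ S.exists_surjective.choose_spec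
    exact hΓ' inferInstance
  let _ : DistribMulAction Γ A :=
    { smul := fun _ a => a
      one_smul := fun _ => rfl
      mul_smul := fun _ _ _ => rfl
      smul_zero := fun _ => rfl
      smul_add := fun _ _ _ => rfl }
  have hA (g : Γ) (a : A) : g • a = a := rfl
  obtain ⟨T⟩ := FiniteClassifyingSpace.nonempty_extensionLift E S
  obtain ⟨ε, hε, hcos⟩ := hcos
  have h := (T.isNearlyExact_bernoulli hcentral hA ν hε).of_isContainedIn
    (MeasuredBoolAlg.isContainedIn_reduced _)
  -- The ultraproduct has only copies of the limit action as factors, so the limit action itself is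
  -- nearly exact and stability applies to it.
  obtain ⟨_, rfl, h⟩ := h.exists_of_isWeaklyContainedIn hw
  obtain ⟨P, hP, h⟩ := h.exists_of_isWeaklyContainedIn (hstable m π hπ s U hU)
  obtain ⟨Q, hQ, h⟩ := h.exists_transitive hP
  obtain ⟨b, hb⟩ := FiniteClassifyingSpace.exists_differential_eq (fun x => (hν.1 x).le) (hcos Q hQ)
    (T.cocycle_mem hcentral hA) h
  exact hΓ' (T.residuallyFinite_of_differential_eq hcentral hA hΓ hQ hb)
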